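/- Let $n\in\mathbb N$ and $\alpha,\beta\in\mathbb R$ with $\beta\neq 0$ and $1<\beta-2\alpha<n$. There is a finite constant $C_{n,\alpha,\beta}\ge 0$, depending only on $n,\alpha,\beta$, such that the following holds. Let $\phi_0\in L^2(\mathbb R^n)$ and let $\phi\in C(\mathbb R;L^2(\mathbb R^n))$ be the (distributional) solution of $$i\phi_t=(-\Delta)^{\beta/2}\phi\quad\text{in }\mathbb R^{n+1},\qquad \phi(\cdot,0)=\phi_0 ,$$ where $|\nabla|^{s}=(-\Delta)^{s/2}$ denotes the Fourier multiplier with symbol $|\xi|^{s}$ (for the transform $\hat f(\xi)=\int e^{-ix\cdot\xi}f(x)\,dx$), acting on $L^2(\mathbb R^n)$ in the sense of distributions, i.e. by duality with those Schwartz functions $\eta$ for which $|\xi|^{s}\hat\eta\in L^2(\mathbb R^n)$ (all Schwartz functions if $s>-n/2$, which for $s=\alpha$ and $s=\beta$ is automatic when $\beta>0$). Then $|\nabla|^\alpha\phi$ is given, for almost every $t$, by a function which is measurable in $(x,t)$ and satisfies $$\int_{-\infty}^{\infty}\int_{\mathbb R^n}\frac{\big||\nabla|^\alpha\phi(x,t)\big|^2}{|x|^{\beta-2\alpha}}\,dx\,dt\le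 C_{n,\alpha,\beta}\,\|\phi_0\|_{L^2(\mathbb R^n)}^2 .$$ Moreover, if $\phi_0$ is spherically symmetric, then equality holds with the same constant: $$\int_{-\infty}^{\infty}\int_{\mathbb R^n}\frac{\big||\nabla|^\alpha\phi(x,t)\big|^2}{|x|^{\beta-2\alpha}}\,dx\,dt= C_{n,\alpha,\beta}\,\|\phi_0\|_{L^2(\mathbb R^n)}^2 .$$ -/

import Mathlib

open MeasureTheory SchwartzMap FourierTransform
open scoped ENNReal NNReal

noncomputable section

/-- The space `ℝⁿ` with its Euclidean norm. -/
abbrev Eucl (n : ℕ) : Type := EuclideanSpace ℝ (Fin n)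

/-- The complex space `L²(ℝⁿ)`. -/
abbrev L2 (n : ℕ) : Type := Lp ℂ 2 (volume : Measure (Eucl n))

/-- The symbol of `|∇|^s = (-Δ)^{s/2}`. Mathlib's Fourier transform has the kernel
`exp (-2πi⟨x, ξ⟩)`, so `-Δ` has the symbol `(2π‖ξ‖)²`. -/
def gradSymbol {n : ℕ} (s : ℝ) (ξ : Eucl n) : ℝ := (2 * Real.pi * ‖ξ‖) ^ s

/-- `𝓕 ψ` is a Schwartz function to which `|∇|^s` can be applied within `L²`. For `s > -n/2`
every Schwartz function `ψ` has this property; for `s ≤ -n/2` it asks for enough vanishing of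
`ψ` at the origin. -/
def GradTest {n : ℕ} (s : ℝ) (ψ : 𝓢(Eucl n, ℂ)) : Prop :=
  MemLp (fun ξ : Eucl n => (gradSymbol s ξ : ℂ) * ψ ξ) 2 volume

/-- The value of the distribution `|∇|^s f`, `f ∈ L²(ℝⁿ)`, at the test function `𝓕 ψ`:
the Fourier transform of `|∇|^s f` is `(2π‖ξ‖)^s 𝓕 f (ξ)`, and `⟨T, 𝓕 ψ⟩ = ⟨𝓕 T, ψ⟩`. -/
def gradPairing {n : ℕ} (s : ℝ) (f : L2 n) (ψ : 𝓢(Eucl n, ℂ)) : ℂ :=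
  ∫ ξ : Eucl n, (gradSymbol s ξ : ℂ) * (𝓕 f : L2 n) ξ * ψ ξ

/-- The distribution `|∇|^s f` is the function `v`. -/
def IsFracGrad {n : ℕ} (s : ℝ) (f : L2 n) (v : Eucl n → ℂ) : Prop :=
  ∀ ψ : 𝓢(Eucl n, ℂ), GradTest s ψ →
    Integrable (fun x : Eucl n => v x * (𝓕 ψ : 𝓢(Eucl n, ℂ)) x) ∧
    ∫ x : Eucl n, v x * (𝓕 ψ : 𝓢(Eucl n, ℂ)) x = gradPairing s f ψ

/-- `φ ∈ C(ℝ; L²(ℝⁿ))` solves `i φ_t = (-Δ)^{β/2} φ`, `φ(0) = φ₀`, the equation being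
understood in the sense of distributions in `x` at every time `t`. -/
structure IsSolution {n : ℕ} (β : ℝ) (φ₀ : L2 n) (φ : ℝ → L2 n) : Prop where
  continuous : Continuous φ
  initial : φ 0 = φ₀
  equation : ∀ ψ : 𝓢(Eucl n, ℂ), GradTest β ψ → ∀ t : ℝ,
    HasDerivAt (fun τ : ℝ => Complex.I * ∫ x : Eucl n, φ τ x * (𝓕 ψ : 𝓢(Eucl n, ℂ)) x)
      (gradPairing β (φ t) ψ) t

/-- The measurable function `u` on space-time, `u (t, x)`, is `|∇|^α φ (x, t)`. -/
structure IsSpaceTimeFracGrad {n : ℕ} (α : ℝ) (φ : ℝ → L2 n) (u : ℝ × Eucl n → ℂ) : Prop where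
  measurable : AEStronglyMeasurable u volume
  eq : ∀ᵐ t : ℝ, IsFracGrad α (φ t) (fun x => u (t, x))

/-- Spherical symmetry of an `L²` function: invariance under all orthogonal maps. -/
def IsSphericallySymmetric {n : ℕ} (f : L2 n) : Prop :=
  ∀ R : Eucl n ≃ₗᵢ[ℝ] Eucl n, (fun x => f (R x)) =ᵐ[volume] fun x => f x

/-- `∫_ℝ ∫_{ℝⁿ} |u(t, x)|² / |x|^γ dx dt`, with values in `[0, ∞]`. -/
def weightedNormSq {n : ℕ} (γ : ℝ) (u : ℝ × Eucl n → ℂ) : ℝ≥0∞ :=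
  ∫⁻ t : ℝ, ∫⁻ x : Eucl n, ENNReal.ofReal (‖u (t, x)‖ ^ 2 / ‖x‖ ^ γ)

end

/-!
On the Fourier side the solution is `exp (-i t (2π‖ξ‖)^β) g(ξ)` with `g = 𝓕 φ₀`; testing the
equation against smooth functions supported away from the origin proves this
(`fourier_solution_ae_eq`). Put `γ = β - 2 α`. In polar coordinates `ξ = rθ`, for fixed `x`,
`|∇|^α φ (t, x)` is a superposition over `r > 0` of the oscillations `exp (-i t (2πr)^β)`, with
coefficients `r^(n-1) (2πr)^α (g(r ·) σ)^ (r x)`, where `σ` is the surface measure of the unit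
sphere and `^` is the Fourier transform. Taking `(2πr)^β / (2π)` as a new variable, Plancherel's
theorem in `t` turns the time integral into an integral over `r`
(`lintegral_enorm_sq_integral_oscillation`). The weight `‖x‖^(-γ)` is homogeneous, and the powers
of `r` add up to `r^(n-1)`, so the estimate reduces, sphere by sphere, to
`∫ ‖y‖^(-γ) |(h σ)^ (y)|² dy ≤ D ∫ |h|² dσ`, with equality for constant `h`.

For that estimate, write `‖y‖^(-γ)` as a superposition of the Gaussians `exp (-π s ‖y‖²)`. Each of
them gives the quadratic form on `L²(σ)` of the kernel `s^(-n/2) exp (-π ‖θ - θ'‖² / s)`, which is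
positive and rotation invariant. By the Schur test its norm is its integral in `θ'`, and constants
attain it (`lintegral_weight_sphereExtension_le`, `lintegral_weight_sphereExtension_of_ae_const`).
The resulting constant `D` is finite because the integral of the kernel is `O(s^(-1/2))` for small
`s` and `O(s^(-n/2))` for large `s`, and `1 < γ < n`.

All integrals converge absolutely if `g` is supported in an annulus (`weightedNormSq_freeGrad`).
For general `g`, the functions belonging to the restrictions of `g` to growing annuli converge in
the weighted space-time `L²` space, and for almost every `t` a subsequence converges in the weighted
`L²` space in `x`, which is enough to identify the limit with `|∇|^α φ`
(`exists_spaceTime_gradient`).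
If `φ₀` is spherically symmetric then `g` is almost everywhere a function of `‖ξ‖`
(`exists_fourier_ae_eq_comp_norm`), hence constant on almost every sphere.
-/

noncomputable section

/-! ### The Fourier transform on `L²` -/

section Fourier

variable {E : Type*} [NormedAddCommGroup E] [InnerProductSpace ℝ E] [FiniteDimensional ℝ E]
  [MeasurableSpace E] [BorelSpace E]

/-- A locally integrable function is determined by its pairings with Schwartz functions. -/
theorem ae_eq_of_integral_mul_schwartz {f g : E → ℂ} (hf : LocallyIntegrable f volume)
    (hg : LocallyIntegrable g volume)
    (h : ∀ ψ : 𝓢(E, ℂ), ∫ x, f x * ψ x = ∫ x, g x * ψ x) : f =ᵐ[volume] g := by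
  apply ae_eq_of_integral_contDiff_smul_eq hf hg
  intro χ χ_smooth χ_cpt
  have h₁ : HasCompactSupport (Complex.ofRealCLM ∘ χ) := χ_cpt.comp_left rfl
  have h₂ : ContDiff ℝ ((⊤ : ℕ∞) : WithTop ℕ∞) (Complex.ofRealCLM ∘ χ) :=
    Complex.ofRealCLM.contDiff.comp χ_smooth
  have := h (h₁.toSchwartzMap h₂)
  simpa [mul_comm] using this

/-- The Fourier transform on `L²` is self-adjoint for the bilinear pairing. -/
theorem integral_Lp_fourier_mul (f : Lp ℂ 2 (volume : Measure E)) (ψ : 𝓢(E, ℂ)) :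
    ∫ x, (𝓕 f : Lp ℂ 2 (volume : Measure E)) x * ψ x = ∫ x, f x * (𝓕 ψ : 𝓢(E, ℂ)) x := by
  have h := congrArg (fun T : 𝓢'(E, ℂ) => T ψ)
    (Lp.fourier_toTemperedDistribution_eq (E := E) (F := ℂ) f)
  simp only [TemperedDistribution.fourier_apply] at h
  rw [Lp.toTemperedDistribution_apply, Lp.toTemperedDistribution_apply] at h
  simpa only [smul_eq_mul, mul_comm] using h.symm

theorem integral_fourier_mul_of_integrable {f : E → ℂ} (hf : Integrable f) (ψ : 𝓢(E, ℂ)) :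
    ∫ x, 𝓕 f x * ψ x = ∫ x, f x * (𝓕 ψ : 𝓢(E, ℂ)) x := by
  have := VectorFourier.integral_bilin_fourierIntegral_eq_flip (.mul ℂ ℂ) (L := innerₗ E)
    Real.continuous_fourierChar continuous_inner hf
    (ψ.integrable (μ := volume))
  simpa [fourier_coe] using! this

/-- For the inverse transform of an integrable function, `∫ 𝓕⁻ f * 𝓕 ψ = ∫ f * ψ`. -/
theorem integral_fourierInv_mul_fourier {f : E → ℂ} (hf : Integrable f) (ψ : 𝓢(E, ℂ)) :
    ∫ x, 𝓕⁻ f x * (𝓕 ψ : 𝓢(E, ℂ)) x = ∫ x, f x * ψ x := by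
  have h := integral_fourier_mul_of_integrable hf (𝓕⁻ ψ)
  rw [FourierTransform.fourier_fourierInv_eq] at h
  rw [← h, ← integral_neg_eq_self]
  congr 1 with x
  rw [Real.fourierInv_eq_fourier_neg, neg_neg, fourierInv_coe, Real.fourierInv_eq_fourier_neg,
    fourier_coe]

theorem continuous_fourier_of_integrable {f : E → ℂ} (hf : Integrable f) : Continuous (𝓕 f) :=
  VectorFourier.fourierIntegral_continuous Real.continuous_fourierChar continuous_inner hf

/-- On `L¹ ∩ L²` the Fourier transform of `L²` is given by the Fourier integral. -/
theorem Lp_fourier_toLp_ae_eq {f : E → ℂ} (hf : Integrable f) (hf2 : MemLp f 2) :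
    (𝓕 (hf2.toLp f) : Lp ℂ 2 (volume : Measure E)) =ᵐ[volume] 𝓕 f := by
  apply ae_eq_of_integral_mul_schwartz
  · exact (Lp.memLp _).locallyIntegrable (by norm_num)
  · exact (continuous_fourier_of_integrable hf).locallyIntegrable
  intro ψ
  rw [integral_Lp_fourier_mul, integral_fourier_mul_of_integrable hf]
  apply integral_congr_ae
  filter_upwards [hf2.coeFn_toLp] with x hx
  rw [hx]

theorem lintegral_enorm_sq_eq_eLpNorm {α : Type*} [MeasurableSpace α] {μ : Measure α}
    (f : α → ℂ) : ∫⁻ x, ‖f x‖ₑ ^ 2 ∂μ = eLpNorm f 2 μ ^ 2 := by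
  rw [eLpNorm_eq_lintegral_rpow_enorm_toReal (by norm_num) (by norm_num)]
  simp only [ENNReal.toReal_ofNat, ENNReal.rpow_ofNat, one_div]
  rw [← ENNReal.rpow_natCast, ← ENNReal.rpow_mul]
  norm_num

/-- Plancherel's theorem on `L¹ ∩ L²`. -/
theorem lintegral_enorm_fourier_sq {f : E → ℂ} (hf : Integrable f) (hf2 : MemLp f 2) :
    ∫⁻ x, ‖𝓕 f x‖ₑ ^ 2 = ∫⁻ x, ‖f x‖ₑ ^ 2 := by
  rw [lintegral_enorm_sq_eq_eLpNorm, lintegral_enorm_sq_eq_eLpNorm,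
    ← eLpNorm_congr_ae (Lp_fourier_toLp_ae_eq hf hf2), ← Lp.enorm_def,
    ← ofReal_norm, Lp.norm_fourier_eq, ofReal_norm, Lp.enorm_def,
    eLpNorm_congr_ae hf2.coeFn_toLp]

end Fourier

/-! ### Radial functions -/

section Radial

variable {n : ℕ}

theorem fourier_comp_linearIsometry_ae_eq {f : L2 n} (hf : IsSphericallySymmetric f)
    (R : Eucl n ≃ₗᵢ[ℝ] Eucl n) :
    (fun x => (𝓕 f : L2 n) (R x)) =ᵐ[volume] fun x => (𝓕 f : L2 n) x := by
  have hmp := R.measurePreserving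
  apply ae_eq_of_integral_mul_schwartz
  · exact ((Lp.memLp (𝓕 f : L2 n)).comp_measurePreserving hmp).locallyIntegrable (by norm_num)
  · exact (Lp.memLp (𝓕 f : L2 n)).locallyIntegrable (by norm_num)
  intro ψ
  -- Move the rotation to the test function, where it commutes with the Fourier integral.
  set ψR : 𝓢(Eucl n, ℂ) :=
    SchwartzMap.compCLMOfContinuousLinearEquiv ℂ R.symm.toContinuousLinearEquiv ψ
  have hψR : ∀ x, ψR x = ψ (R.symm x) := fun x => rfl
  have h1 : ∫ x, (𝓕 f : L2 n) (R x) * ψ x = ∫ x, (𝓕 f : L2 n) x * ψR x := by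
    rw [← hmp.integral_comp R.toHomeomorph.measurableEmbedding
      (fun x => (𝓕 f : L2 n) x * ψR x)]
    simp [hψR]
  have h2 : ∀ x, (𝓕 ψR : 𝓢(Eucl n, ℂ)) (R x) = (𝓕 ψ : 𝓢(Eucl n, ℂ)) x := by
    intro x
    rw [fourier_coe, fourier_coe]
    have := Real.fourier_comp_linearIsometry R.symm (ψ : Eucl n → ℂ) (R x)
    simp only [LinearIsometryEquiv.symm_apply_apply] at this
    exact this
  rw [h1, integral_Lp_fourier_mul, integral_Lp_fourier_mul,
    ← hmp.integral_comp R.toHomeomorph.measurableEmbedding]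
  apply integral_congr_ae
  filter_upwards [hf R] with x hx
  rw [hx, h2]

theorem exists_linearIsometryEquiv_apply_eq {x y : Eucl n} (h : ‖x‖ = ‖y‖) :
    ∃ R : Eucl n ≃ₗᵢ[ℝ] Eucl n, R x = y :=
  ⟨_, Submodule.reflection_sub h⟩

/-- A locally integrable function that is invariant almost everywhere under each orthogonal map
depends almost everywhere only on the norm: its averages over balls are radial, and by Lebesgue's
differentiation theorem they converge to it. -/
theorem exists_ae_eq_comp_norm {f : Eucl n → ℂ} (hf : LocallyIntegrable f volume)
    (hR : ∀ R : Eucl n ≃ₗᵢ[ℝ] Eucl n, (fun x => f (R x)) =ᵐ[volume] f) :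
    ∃ G : ℝ → ℂ, f =ᵐ[volume] fun x => G ‖x‖ := by
  classical
  set av : ℕ → Eucl n → ℂ := fun k x => ⨍ y in Metric.closedBall x (1 / ((k : ℝ) + 1)), f y
  have hav : ∀ k x y, ‖x‖ = ‖y‖ → av k x = av k y := by
    intro k x y hxy
    obtain ⟨R, rfl⟩ := exists_linearIsometryEquiv_apply_eq hxy
    have hpre : R ⁻¹' (Metric.closedBall (R x) (1 / ((k : ℝ) + 1)))
        = Metric.closedBall x (1 / ((k : ℝ) + 1)) := by
      ext z; simp
    simp only [av, setAverage_eq]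
    rw [← R.measurePreserving.setIntegral_preimage_emb R.toHomeomorph.measurableEmbedding f
        (Metric.closedBall (R x) _), measureReal_def, measureReal_def,
      ← R.measurePreserving.measure_preimage
        (s := Metric.closedBall (R x) _) measurableSet_closedBall.nullMeasurableSet, hpre]
    congr 1
    exact integral_congr_ae (ae_restrict_of_ae (hR R).symm)
  have hlim : ∀ᵐ x : Eucl n, Filter.Tendsto (fun k => av k x) Filter.atTop (nhds (f x)) := by
    filter_upwards [IsUnifLocDoublingMeasure.ae_tendsto_average volume hf 1] with x hx
    refine hx (fun _ => x) (fun k : ℕ => 1 / ((k : ℝ) + 1)) ?_ ?_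
    · refine tendsto_nhdsWithin_iff.2 ⟨tendsto_one_div_add_atTop_nhds_zero_nat, ?_⟩
      exact Filter.Eventually.of_forall fun k => Set.mem_Ioi.2 (by positivity)
    · exact Filter.Eventually.of_forall fun k => by simp; positivity
  refine ⟨fun r => if h : ∃ x : Eucl n, ‖x‖ = r then
    Filter.limUnder Filter.atTop (fun k => av k h.choose) else 0, ?_⟩
  filter_upwards [hlim] with x hx
  have h : ∃ y : Eucl n, ‖y‖ = ‖x‖ := ⟨x, rfl⟩
  simp only [h, dif_pos]
  have : (fun k => av k h.choose) = fun k => av k x := by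
    ext k; exact hav k _ _ h.choose_spec
  rw [this, hx.limUnder_eq]

theorem exists_fourier_ae_eq_comp_norm {f : L2 n} (hf : IsSphericallySymmetric f) :
    ∃ G : ℝ → ℂ, (𝓕 f : L2 n) =ᵐ[volume] fun x => G ‖x‖ :=
  exists_ae_eq_comp_norm ((Lp.memLp _).locallyIntegrable (by norm_num))
    (fourier_comp_linearIsometry_ae_eq hf)

end Radial

/-! ### Solutions on the Fourier side -/

section Solution

variable {n : ℕ}

theorem integrable_L2_mul (f : L2 n) {p : Eucl n → ℂ} (hp : MemLp p 2 volume) :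
    Integrable (fun x => f x * p x) :=
  (Lp.memLp f).integrable_mul hp

/-- The Cauchy–Schwarz inequality for the bilinear pairing of `L²`. -/
theorem norm_integral_L2_mul_le (f : L2 n) {p : Eucl n → ℂ} (hp : MemLp p 2 volume) :
    ‖∫ x, f x * p x‖ ≤ ‖f‖ * (eLpNorm p 2 volume).toReal := by
  have hs : MemLp (fun x => (starRingEnd ℂ) (p x)) 2 volume := hp.star
  have h := norm_inner_le_norm (𝕜 := ℂ) (hs.toLp _) f
  have h1 : inner ℂ (hs.toLp _) f = ∫ x, f x * p x := by
    rw [L2.inner_def]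
    apply integral_congr_ae
    filter_upwards [hs.coeFn_toLp] with x hx
    rw [hx]
    simp [mul_comm]
  have h2 : ‖hs.toLp _‖ = (eLpNorm p 2 volume).toReal := by
    rw [Lp.norm_toLp]
    congr 1
    exact eLpNorm_congr_norm_ae (Filter.Eventually.of_forall fun x => by simp)
  rw [h1, h2] at h
  linarith [mul_comm ‖f‖ (eLpNorm p 2 volume).toReal]

theorem contDiffAt_gradSymbol (s : ℝ) {ξ : Eucl n} (hξ : ξ ≠ 0) :
    ContDiffAt ℝ ((⊤ : ℕ∞) : WithTop ℕ∞) (fun η : Eucl n => gradSymbol s η) ξ := by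
  have h0 : 2 * Real.pi * ‖ξ‖ ≠ 0 := by positivity
  exact (contDiffAt_const.mul (contDiffAt_norm ℝ hξ)).rpow_const_of_ne h0

theorem measurable_gradSymbol (s : ℝ) : Measurable (fun ξ : Eucl n => gradSymbol s ξ) := by
  unfold gradSymbol; fun_prop

theorem gradSymbol_nonneg (s : ℝ) (ξ : Eucl n) : 0 ≤ gradSymbol s ξ := by
  unfold gradSymbol; positivity

/-- Multiplying a smooth function supported away from the origin by a function that is smooth
away from the origin gives a smooth function. -/
theorem contDiff_mul_of_tsupport_subset {m : Eucl n → ℂ} {χ : Eucl n → ℝ}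
    (hm : ∀ ξ ≠ 0, ContDiffAt ℝ ((⊤ : ℕ∞) : WithTop ℕ∞) m ξ)
    (hχ : ContDiff ℝ ((⊤ : ℕ∞) : WithTop ℕ∞) χ) (hs : tsupport χ ⊆ {0}ᶜ) :
    ContDiff ℝ ((⊤ : ℕ∞) : WithTop ℕ∞) (fun ξ => m ξ * (χ ξ : ℂ)) := by
  rw [contDiff_iff_contDiffAt]
  intro ξ
  by_cases hξ : ξ = 0
  · have h0 : ξ ∉ tsupport χ := fun h => hs h hξ
    have : (fun η => m η * (χ η : ℂ)) =ᶠ[nhds ξ] fun _ => 0 := by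
      filter_upwards [notMem_tsupport_iff_eventuallyEq.1 h0] with η hη
      simp [hη]
    exact contDiffAt_const.congr_of_eventuallyEq this
  · exact (hm ξ hξ).mul (Complex.ofRealCLM.contDiff.comp hχ).contDiffAt

theorem hasCompactSupport_mul_ofReal {m : Eucl n → ℂ} {χ : Eucl n → ℝ}
    (hχ : HasCompactSupport χ) : HasCompactSupport (fun ξ => m ξ * (χ ξ : ℂ)) :=
  HasCompactSupport.mul_left (f := m) (f' := fun ξ => (χ ξ : ℂ))
    (hχ.comp_left (g := Complex.ofReal) rfl)

theorem memLp_mul_of_tsupport_subset {m : Eucl n → ℂ} {χ : Eucl n → ℝ}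
    (hm : ∀ ξ ≠ 0, ContDiffAt ℝ ((⊤ : ℕ∞) : WithTop ℕ∞) m ξ)
    (hχ : ContDiff ℝ ((⊤ : ℕ∞) : WithTop ℕ∞) χ) (hc : HasCompactSupport χ)
    (hs : tsupport χ ⊆ {0}ᶜ) : MemLp (fun ξ => m ξ * (χ ξ : ℂ)) 2 volume :=
  (contDiff_mul_of_tsupport_subset hm hχ hs).continuous.memLp_of_hasCompactSupport
    (hasCompactSupport_mul_ofReal hc)

theorem norm_cexp_mul_I_sub_one_sub_le (y : ℝ) :
    ‖Complex.exp (y * Complex.I) - 1 - y * Complex.I‖ ≤ 3 * y ^ 2 := by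
  have hn : ‖(y : ℂ) * Complex.I‖ = |y| := by simp
  by_cases hy : |y| ≤ 1
  · have := Complex.norm_exp_sub_one_sub_id_le (x := y * Complex.I) (by rwa [hn])
    rw [hn, sq_abs] at this
    nlinarith [sq_nonneg y]
  · push Not at hy
    have h1 : ‖Complex.exp (y * Complex.I) - 1 - y * Complex.I‖ ≤ 1 + 1 + |y| := by
      refine (norm_sub_le _ _).trans ?_
      rw [hn]
      gcongr
      refine (norm_sub_le _ _).trans ?_
      rw [Complex.norm_exp_ofReal_mul_I, norm_one]
    have : |y| ^ 2 = y ^ 2 := sq_abs y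
    nlinarith

/-- The free evolution `exp (-i t (2π‖ξ‖)^β)` on the Fourier side. -/
def evolutionSymbol (β t : ℝ) (ξ : Eucl n) : ℂ :=
  Complex.exp (-(t * gradSymbol β ξ : ℝ) * Complex.I)

theorem norm_evolutionSymbol (β t : ℝ) (ξ : Eucl n) : ‖evolutionSymbol β t ξ‖ = 1 := by
  rw [evolutionSymbol, ← Complex.ofReal_neg, Complex.norm_exp_ofReal_mul_I]

theorem measurable_evolutionSymbol (β t : ℝ) :
    Measurable (fun ξ : Eucl n => evolutionSymbol β t ξ) := by
  have := measurable_gradSymbol (n := n) β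
  unfold evolutionSymbol
  fun_prop

theorem evolutionSymbol_neg_mul (β t : ℝ) (ξ : Eucl n) :
    evolutionSymbol β (-t) ξ * evolutionSymbol β t ξ = 1 := by
  rw [evolutionSymbol, evolutionSymbol, ← Complex.exp_add]
  push_cast
  simp

theorem contDiffAt_evolutionSymbol (β t : ℝ) {ξ : Eucl n} (hξ : ξ ≠ 0) :
    ContDiffAt ℝ ((⊤ : ℕ∞) : WithTop ℕ∞) (fun η : Eucl n => evolutionSymbol β t η) ξ := by
  have h := (Complex.ofRealCLM.contDiff (n := ((⊤ : ℕ∞) : WithTop ℕ∞))).contDiffAt.comp ξ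
    (contDiffAt_const.mul (contDiffAt_gradSymbol β hξ) : ContDiffAt ℝ _
      (fun η : Eucl n => t * gradSymbol β η) ξ)
  exact (h.neg.mul contDiffAt_const).cexp

theorem norm_evolutionSymbol_taylor_le (β t τ : ℝ) (ξ : Eucl n) :
    ‖evolutionSymbol β (-τ) ξ - evolutionSymbol β (-t) ξ
      - (τ - t : ℝ) * (Complex.I * gradSymbol β ξ * evolutionSymbol β (-t) ξ)‖
      ≤ 3 * (τ - t) ^ 2 * gradSymbol β ξ ^ 2 := by
  have h : evolutionSymbol β (-τ) ξ - evolutionSymbol β (-t) ξ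
      - (τ - t : ℝ) * (Complex.I * gradSymbol β ξ * evolutionSymbol β (-t) ξ)
      = evolutionSymbol β (-t) ξ * (Complex.exp (((τ - t) * gradSymbol β ξ : ℝ) * Complex.I)
        - 1 - ((τ - t) * gradSymbol β ξ : ℝ) * Complex.I) := by
    have : evolutionSymbol β (-τ) ξ = evolutionSymbol β (-t) ξ *
        Complex.exp (((τ - t) * gradSymbol β ξ : ℝ) * Complex.I) := by
      rw [evolutionSymbol, evolutionSymbol, ← Complex.exp_add]
      congr 1
      push_cast
      ring
    rw [this]
    push_cast
    ring
  rw [h, norm_mul, norm_evolutionSymbol, one_mul]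
  refine (norm_cexp_mul_I_sub_one_sub_le _).trans_eq ?_
  ring

/-- Testing the equation against `exp (i t (2π‖ξ‖)^β) χ`, with `χ` supported away from the
origin, shows that the conjugated solution is constant in time. -/
theorem hasDerivAt_integral_fourier_mul {β : ℝ} {φ₀ : L2 n} {φ : ℝ → L2 n}
    (h : IsSolution β φ₀ φ) {χ : Eucl n → ℝ}
    (hχ : ContDiff ℝ ((⊤ : ℕ∞) : WithTop ℕ∞) χ) (hc : HasCompactSupport χ)
    (hs : tsupport χ ⊆ {0}ᶜ) (t : ℝ) :
    HasDerivAt (fun τ => ∫ ξ, (𝓕 (φ τ) : L2 n) ξ * (evolutionSymbol β (-τ) ξ * χ ξ)) 0 t := by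
  have hE : ∀ τ, ∀ ξ : Eucl n, ξ ≠ 0 → ContDiffAt ℝ ((⊤ : ℕ∞) : WithTop ℕ∞)
      (fun ξ => evolutionSymbol β (-τ) ξ) ξ := fun τ ξ hξ => contDiffAt_evolutionSymbol β _ hξ
  have hω : ∀ ξ : Eucl n, ξ ≠ 0 → ContDiffAt ℝ ((⊤ : ℕ∞) : WithTop ℕ∞)
      (fun ξ : Eucl n => (gradSymbol β ξ : ℂ)) ξ := fun ξ hξ =>
    Complex.ofRealCLM.contDiff.contDiffAt.comp ξ (contDiffAt_gradSymbol β hξ)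
  have hωE : ∀ ξ : Eucl n, ξ ≠ 0 → ContDiffAt ℝ ((⊤ : ℕ∞) : WithTop ℕ∞)
      (fun ξ : Eucl n => Complex.I * gradSymbol β ξ * evolutionSymbol β (-t) ξ) ξ :=
    fun ξ hξ => (contDiffAt_const.mul (hω ξ hξ)).mul (hE t ξ hξ)
  set Ψ : 𝓢(Eucl n, ℂ) := (hasCompactSupport_mul_ofReal
    (m := fun ξ => evolutionSymbol β (-t) ξ) hc).toSchwartzMap
      (contDiff_mul_of_tsupport_subset (hE t) hχ hs) with hΨ
  have hΨ_apply : ∀ ξ, Ψ ξ = evolutionSymbol β (-t) ξ * χ ξ := fun ξ => rfl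
  have hM : ∀ τ, MemLp (fun ξ => evolutionSymbol β (-τ) ξ * (χ ξ : ℂ)) 2 volume := fun τ =>
    memLp_mul_of_tsupport_subset (hE τ) hχ hc hs
  have hMω := memLp_mul_of_tsupport_subset hωE hχ hc hs
  have hMω2 := memLp_mul_of_tsupport_subset (m := fun ξ => 3 * (gradSymbol β ξ : ℂ) ^ 2)
    (fun ξ hξ => contDiffAt_const.mul ((hω ξ hξ).pow 2)) hχ hc hs
  have hGT : GradTest β Ψ := by
    have := memLp_mul_of_tsupport_subset
      (m := fun ξ => (gradSymbol β ξ : ℂ) * evolutionSymbol β (-t) ξ)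
      (fun ξ hξ => (hω ξ hξ).mul (hE t ξ hξ)) hχ hc hs
    unfold GradTest
    simpa only [hΨ_apply, mul_assoc] using this
  -- The contribution of the time derivative of the solution.
  have hd1 : HasDerivAt (fun τ => ∫ ξ, (𝓕 (φ τ) : L2 n) ξ * Ψ ξ)
      (-Complex.I * gradPairing β (φ t) Ψ) t := by
    have := (h.equation Ψ hGT t).const_mul (-Complex.I)
    refine this.congr_of_eventuallyEq (Filter.Eventually.of_forall fun τ => ?_)
    simp only
    rw [integral_Lp_fourier_mul, ← mul_assoc]
    simp
  -- The contribution of the time derivative of the test function.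
  set J : ℂ := ∫ ξ, (𝓕 (φ t) : L2 n) ξ
    * (Complex.I * gradSymbol β ξ * evolutionSymbol β (-t) ξ * χ ξ) with hJ
  have hd2 : HasDerivAt (fun τ => ∫ ξ, (𝓕 (φ τ) : L2 n) ξ *
      (evolutionSymbol β (-τ) ξ * χ ξ - Ψ ξ)) J t := by
    rw [hasDerivAt_iff_isLittleO]
    set K₁ := (eLpNorm (fun ξ => 3 * (gradSymbol β ξ : ℂ) ^ 2 * (χ ξ : ℂ)) 2 volume).toReal
    set K₂ := (eLpNorm (fun ξ => Complex.I * gradSymbol β ξ * evolutionSymbol β (-t) ξ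
      * (χ ξ : ℂ)) 2 volume).toReal
    have hbound : ∀ τ, ‖(∫ ξ, (𝓕 (φ τ) : L2 n) ξ * (evolutionSymbol β (-τ) ξ * χ ξ - Ψ ξ))
        - (∫ ξ, (𝓕 (φ t) : L2 n) ξ * (evolutionSymbol β (-t) ξ * χ ξ - Ψ ξ)) - (τ - t) • J‖
        ≤ ‖(τ - t) * (|τ - t| * ‖φ τ‖ * K₁ + ‖φ τ - φ t‖ * K₂)‖ := by
      intro τ
      have e0 : (∫ ξ, (𝓕 (φ t) : L2 n) ξ * (evolutionSymbol β (-t) ξ * χ ξ - Ψ ξ)) = 0 := by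
        simp [hΨ_apply]
      have hR : MemLp (fun ξ => (evolutionSymbol β (-τ) ξ * (χ ξ : ℂ) - Ψ ξ)
          - ((τ - t : ℝ) : ℂ) * (Complex.I * gradSymbol β ξ * evolutionSymbol β (-t) ξ * χ ξ))
          2 volume :=
        ((hM τ).sub (hM t)).sub (hMω.const_mul _)
      have e1 : (∫ ξ, (𝓕 (φ τ) : L2 n) ξ * (evolutionSymbol β (-τ) ξ * χ ξ - Ψ ξ))
          = (∫ ξ, (𝓕 (φ τ) : L2 n) ξ * ((evolutionSymbol β (-τ) ξ * (χ ξ : ℂ) - Ψ ξ)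
          - ((τ - t : ℝ) : ℂ) * (Complex.I * gradSymbol β ξ * evolutionSymbol β (-t) ξ * χ ξ)))
          + ((τ - t : ℝ) : ℂ) * ∫ ξ, (𝓕 (φ τ) : L2 n) ξ
            * (Complex.I * gradSymbol β ξ * evolutionSymbol β (-t) ξ * χ ξ) := by
        rw [← integral_const_mul, ← integral_add (integrable_L2_mul _ hR)
          ((integrable_L2_mul _ hMω).const_mul _)]
        congr 1 with ξ
        ring
      have e2 : (∫ ξ, (𝓕 (φ τ) : L2 n) ξ
            * (Complex.I * gradSymbol β ξ * evolutionSymbol β (-t) ξ * χ ξ)) - J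
          = ∫ ξ, (𝓕 (φ τ - φ t) : L2 n) ξ
            * (Complex.I * gradSymbol β ξ * evolutionSymbol β (-t) ξ * χ ξ) := by
        rw [hJ, ← integral_sub (integrable_L2_mul _ hMω) (integrable_L2_mul _ hMω)]
        apply integral_congr_ae
        have : (𝓕 (φ τ - φ t) : L2 n) = 𝓕 (φ τ) - 𝓕 (φ t) :=
          (Lp.fourierTransformₗᵢ (Eucl n) ℂ).map_sub _ _
        rw [this]
        filter_upwards [Lp.coeFn_sub (𝓕 (φ τ) : L2 n) (𝓕 (φ t))] with ξ hξ
        rw [hξ, Pi.sub_apply]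
        ring
      have b1 : ‖∫ ξ, (𝓕 (φ τ) : L2 n) ξ * ((evolutionSymbol β (-τ) ξ * (χ ξ : ℂ) - Ψ ξ)
          - ((τ - t : ℝ) : ℂ) * (Complex.I * gradSymbol β ξ * evolutionSymbol β (-t) ξ * χ ξ))‖
          ≤ ‖φ τ‖ * (|τ - t| ^ 2 * K₁) := by
        refine (norm_integral_L2_mul_le _ hR).trans ?_
        rw [Lp.norm_fourier_eq]
        gcongr
        have : eLpNorm (fun ξ => (evolutionSymbol β (-τ) ξ * (χ ξ : ℂ) - Ψ ξ)
          - ((τ - t : ℝ) : ℂ) * (Complex.I * gradSymbol β ξ * evolutionSymbol β (-t) ξ * χ ξ))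
          2 volume ≤ ENNReal.ofReal (|τ - t| ^ 2) * eLpNorm (fun ξ =>
            3 * (gradSymbol β ξ : ℂ) ^ 2 * (χ ξ : ℂ)) 2 volume := by
          apply eLpNorm_le_mul_eLpNorm_of_ae_le_mul
          filter_upwards with ξ
          have hT := norm_evolutionSymbol_taylor_le β t τ ξ
          have : (evolutionSymbol β (-τ) ξ * (χ ξ : ℂ) - Ψ ξ)
            - ((τ - t : ℝ) : ℂ) * (Complex.I * gradSymbol β ξ * evolutionSymbol β (-t) ξ * χ ξ)
            = (evolutionSymbol β (-τ) ξ - evolutionSymbol β (-t) ξ - (τ - t : ℝ) *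
              (Complex.I * gradSymbol β ξ * evolutionSymbol β (-t) ξ)) * χ ξ := by
            rw [hΨ_apply]; ring
          rw [this, norm_mul, norm_mul, norm_mul, norm_pow, Complex.norm_real (gradSymbol β ξ),
            Real.norm_of_nonneg (gradSymbol_nonneg β ξ), sq_abs]
          calc _ ≤ 3 * (τ - t) ^ 2 * gradSymbol β ξ ^ 2 * ‖(χ ξ : ℂ)‖ := by gcongr
            _ = _ := by simp; ring
        have h' := ENNReal.toReal_mono (ENNReal.mul_ne_top ENNReal.ofReal_ne_top
          hMω2.eLpNorm_ne_top) this
        rwa [ENNReal.toReal_mul, ENNReal.toReal_ofReal (by positivity)] at h'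
      have b2 := norm_integral_L2_mul_le (𝓕 (φ τ - φ t) : L2 n) hMω
      rw [Lp.norm_fourier_eq, ← e2] at b2
      have hnn : 0 ≤ |τ - t| * ‖φ τ‖ * K₁ + ‖φ τ - φ t‖ * K₂ := by positivity
      rw [e0, e1, sub_zero, Complex.real_smul, add_sub_assoc, ← mul_sub, norm_mul (τ - t),
        Real.norm_of_nonneg hnn, Real.norm_eq_abs]
      refine (norm_add_le _ _).trans ?_
      rw [norm_mul, Complex.norm_real, Real.norm_eq_abs]
      calc _ ≤ ‖φ τ‖ * (|τ - t| ^ 2 * K₁) + |τ - t| * (‖φ τ - φ t‖ * K₂) := by gcongr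
        _ = _ := by ring
    have hlim : Filter.Tendsto (fun τ => |τ - t| * ‖φ τ‖ * K₁ + ‖φ τ - φ t‖ * K₂)
        (nhds t) (nhds 0) := by
      have hcont : Continuous (fun τ => |τ - t| * ‖φ τ‖ * K₁ + ‖φ τ - φ t‖ * K₂) := by
        have := h.continuous
        fun_prop
      simpa using hcont.tendsto t
    have hO := Asymptotics.IsBigO.of_bound' (l := nhds t) (Filter.Eventually.of_forall hbound)
    refine hO.trans_isLittleO ?_
    have := (Asymptotics.isBigO_refl (fun τ : ℝ => τ - t) (nhds t)).mul_isLittleO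
      ((Asymptotics.isLittleO_one_iff ℝ).2 hlim)
    simpa using this
  have hsum := hd1.add hd2
  have hzero : -Complex.I * gradPairing β (φ t) Ψ + J = 0 := by
    rw [hJ, gradPairing, ← integral_const_mul, ← integral_add]
    · rw [← integral_zero (Eucl n) ℂ]
      congr 1 with ξ
      rw [hΨ_apply]; ring
    · have := (integrable_L2_mul (𝓕 (φ t) : L2 n) hMω).neg
      refine this.congr (Filter.Eventually.of_forall fun ξ => ?_)
      simp only [Pi.neg_apply]
      rw [hΨ_apply]; ring
    · exact integrable_L2_mul _ hMω
  rw [hzero] at hsum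
  refine hsum.congr_of_eventuallyEq (Filter.Eventually.of_forall fun τ => ?_)
  simp only [Pi.add_apply]
  have hΨ2 : MemLp (fun ξ => Ψ ξ) 2 volume := hM t
  rw [← integral_add (integrable_L2_mul _ hΨ2)
    (integrable_L2_mul _ (p := fun ξ => evolutionSymbol β (-τ) ξ * χ ξ - Ψ ξ) ((hM τ).sub hΨ2))]
  congr 1 with ξ
  ring

/-- The solution on the Fourier side. The equation determines it only away from the origin,
which is a null set. -/
theorem fourier_solution_ae_eq [Nontrivial (Eucl n)] {β : ℝ} {φ₀ : L2 n} {φ : ℝ → L2 n}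
    (h : IsSolution β φ₀ φ) (t : ℝ) :
    (𝓕 (φ t) : L2 n) =ᵐ[volume] fun ξ => evolutionSymbol β t ξ * (𝓕 φ₀ : L2 n) ξ := by
  set F : Eucl n → ℂ := fun ξ => evolutionSymbol β (-t) ξ * (𝓕 (φ t) : L2 n) ξ with hF
  have hFm : MemLp F 2 volume := by
    refine (Lp.memLp (𝓕 (φ t) : L2 n)).of_le
      ((measurable_evolutionSymbol β (-t)).aestronglyMeasurable.mul
        (Lp.aestronglyMeasurable _)) (Filter.Eventually.of_forall fun ξ => ?_)
    rw [hF, norm_mul, norm_evolutionSymbol, one_mul]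
  have h0m := Lp.memLp (𝓕 φ₀ : L2 n)
  have key : ∀ᵐ ξ : Eucl n, ξ ∈ ({0}ᶜ : Set (Eucl n)) → F ξ - (𝓕 φ₀ : L2 n) ξ = 0 := by
    refine isOpen_compl_singleton.ae_eq_zero_of_integral_contDiff_smul_eq_zero
      (((hFm.sub h0m).locallyIntegrable (by norm_num)).locallyIntegrableOn _) ?_
    intro χ hχ hc hs
    have hconst := is_const_of_deriv_eq_zero
      (fun τ => (hasDerivAt_integral_fourier_mul h hχ hc hs τ).differentiableAt)
      (fun τ => (hasDerivAt_integral_fourier_mul h hχ hc hs τ).deriv) t 0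
    have hχ2 : MemLp (fun ξ => (χ ξ : ℂ)) 2 volume := by
      have := memLp_mul_of_tsupport_subset (m := fun _ => 1) (fun ξ _ => contDiffAt_const)
        hχ hc hs
      simpa using this
    have hint1 : Integrable (fun ξ => F ξ * (χ ξ : ℂ)) := hFm.integrable_mul hχ2
    have hint2 : Integrable (fun ξ => (𝓕 φ₀ : L2 n) ξ * (χ ξ : ℂ)) := integrable_L2_mul _ hχ2
    have e1 : ∫ ξ, F ξ * (χ ξ : ℂ) = ∫ ξ, (𝓕 φ₀ : L2 n) ξ * (χ ξ : ℂ) := by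
      rw [h.initial] at hconst
      simp only [hF]
      calc _ = _ := by congr 1 with ξ; ring
        _ = _ := hconst
        _ = _ := by congr 1 with ξ; simp [evolutionSymbol]
    calc ∫ ξ, χ ξ • (F ξ - (𝓕 φ₀ : L2 n) ξ)
        = ∫ ξ, (F ξ * (χ ξ : ℂ) - (𝓕 φ₀ : L2 n) ξ * (χ ξ : ℂ)) := by
          congr 1 with ξ; rw [Complex.real_smul]; ring
      _ = 0 := by rw [integral_sub hint1 hint2, e1, sub_self]
  have hne : ∀ᵐ ξ : Eucl n, ξ ≠ 0 := by simp [ae_iff]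
  filter_upwards [key, hne] with ξ hξ hξ0
  have := hξ hξ0
  rw [← sub_eq_zero.1 this, hF, ← mul_assoc, mul_comm (evolutionSymbol β t ξ),
    evolutionSymbol_neg_mul, one_mul]

end Solution

/-! ### Polar coordinates -/

section Polar

open scoped Pointwise

/-- The surface measure of the unit sphere, as a measure on the ambient space. -/
def sphereMeasure (n : ℕ) : Measure (Eucl n) :=
  (volume : Measure (Eucl n)).toSphere.map Subtype.val

/-- The radial measure `r^(n-1) dr` on `(0, ∞)`, as a measure on `ℝ`. -/
def radialMeasure (n : ℕ) : Measure ℝ :=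
  (volume.restrict (Set.Ioi 0)).withDensity fun r => ENNReal.ofReal (r ^ (n - 1))

instance (n : ℕ) : IsFiniteMeasure (sphereMeasure n) := by
  unfold sphereMeasure; infer_instance

instance (n : ℕ) : SFinite (radialMeasure n) := by
  unfold radialMeasure; infer_instance

variable {n : ℕ}

theorem map_volumeIoiPow (k : ℕ) : (Measure.volumeIoiPow k).map Subtype.val
    = (volume.restrict (Set.Ioi (0 : ℝ))).withDensity fun r => ENNReal.ofReal (r ^ k) := by
  ext s hs
  rw [Measure.map_apply measurable_subtype_coe hs, Measure.volumeIoiPow,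
    withDensity_apply _ (measurable_subtype_coe hs), withDensity_apply _ hs,
    setLIntegral_subtype measurableSet_Ioi _ fun r : ℝ => ENNReal.ofReal (r ^ k),
    Subtype.image_preimage_coe, Measure.restrict_restrict hs, Set.inter_comm]

/-- Polar coordinates. -/
theorem measurePreserving_smul_sphereMeasure_prod [Nontrivial (Eucl n)] :
    MeasurePreserving (fun p : Eucl n × ℝ => p.2 • p.1)
      ((sphereMeasure n).prod (radialMeasure n)) volume := by
  refine ⟨by fun_prop, ?_⟩
  have hdim : Module.finrank ℝ (Eucl n) = n := by simp
  have h := (volume : Measure (Eucl n)).measurePreserving_homeomorphUnitSphereProd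
  rw [hdim] at h
  have h1 := MeasurePreserving.symm (homeomorphUnitSphereProd (Eucl n)).toMeasurableEquiv h
  rw [sphereMeasure, radialMeasure, ← map_volumeIoiPow,
    Measure.map_prod_map _ _ measurable_subtype_coe measurable_subtype_coe,
    Measure.map_map (by fun_prop) (by fun_prop)]
  have h2 : (fun p : Eucl n × ℝ => p.2 • p.1) ∘ Prod.map Subtype.val Subtype.val
      = Subtype.val ∘ (homeomorphUnitSphereProd (Eucl n)).toMeasurableEquiv.symm := by
    ext p; rfl
  rw [h2, ← Measure.map_map measurable_subtype_coe (MeasurableEquiv.measurable _), h1.map_eq,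
    map_comap_subtype_coe (measurableSet_singleton _).compl, restrict_compl_singleton]

theorem ae_sphereMeasure_norm_eq_one : ∀ᵐ θ ∂(sphereMeasure n), ‖θ‖ = 1 := by
  rw [sphereMeasure, ae_map_iff measurable_subtype_coe.aemeasurable
    (measurableSet_eq_fun (by fun_prop) (by fun_prop))]
  filter_upwards with θ
  simp

theorem lintegral_eq_polar [Nontrivial (Eucl n)] {f : Eucl n → ℝ≥0∞} (hf : Measurable f) :
    ∫⁻ x, f x = ∫⁻ r in Set.Ioi (0 : ℝ), ENNReal.ofReal (r ^ (n - 1)) *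
      ∫⁻ θ, f (r • θ) ∂(sphereMeasure n) := by
  rw [← (measurePreserving_smul_sphereMeasure_prod (n := n)).lintegral_comp hf,
    lintegral_prod_symm' _ (by fun_prop), radialMeasure,
    lintegral_withDensity_eq_lintegral_mul _ (by fun_prop)]
  · rfl
  · have : Measurable fun p : Eucl n × ℝ => f (p.2 • p.1) := by fun_prop
    exact this.lintegral_prod_left'

theorem integral_eq_polar [Nontrivial (Eucl n)] {f : Eucl n → ℂ} (hf : Integrable f) :
    ∫ x, f x = ∫ r in Set.Ioi (0 : ℝ), ((r ^ (n - 1) : ℝ) : ℂ) *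
      ∫ θ, f (r • θ) ∂(sphereMeasure n) := by
  have hmp := measurePreserving_smul_sphereMeasure_prod (n := n)
  have hint : Integrable (fun p : Eucl n × ℝ => f (p.2 • p.1))
    ((sphereMeasure n).prod (radialMeasure n)) :=
    (hmp.integrable_comp hf.aestronglyMeasurable).2 hf
  rw [← hmp.map_eq, integral_map hmp.aemeasurable (hmp.map_eq ▸ hf.aestronglyMeasurable)]
  rw [integral_prod_symm _ hint, radialMeasure]
  have hd : (fun r : ℝ => ENNReal.ofReal (r ^ (n - 1)))
      = fun r => ((Real.toNNReal (r ^ (n - 1)) : ℝ≥0) : ℝ≥0∞) := rfl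
  rw [hd, integral_withDensity_eq_integral_smul (by fun_prop)]
  refine setIntegral_congr_fun measurableSet_Ioi fun r hr => ?_
  have hr : (0 : ℝ) < r := hr
  simp only [NNReal.smul_def, Complex.real_smul]
  rw [Real.coe_toNNReal _ (by positivity)]

/-- A property that holds almost everywhere holds almost everywhere on almost every sphere. -/
theorem ae_ae_sphereMeasure_of_ae [Nontrivial (Eucl n)] {p : Eucl n → Prop}
    (hp : ∀ᵐ x, p x) :
    ∀ᵐ r ∂(volume.restrict (Set.Ioi (0 : ℝ))), ∀ᵐ θ ∂(sphereMeasure n), p (r • θ) := by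
  have hmp := measurePreserving_smul_sphereMeasure_prod (n := n)
  have h1 := hmp.quasiMeasurePreserving.ae hp
  have hsw : ∀ᵐ q ∂((radialMeasure n).prod (sphereMeasure n)), p (q.1 • q.2) :=
    Measure.measurePreserving_swap.quasiMeasurePreserving.ae h1
  have h2 := Measure.ae_ae_of_ae_prod hsw
  rw [radialMeasure, ae_withDensity_iff (by fun_prop)] at h2
  filter_upwards [h2, ae_restrict_mem measurableSet_Ioi] with r hr hr0
  have hr0 : (0 : ℝ) < r := hr0
  exact hr (by simpa using by positivity)

theorem map_sphereMeasure (R : Eucl n ≃ₗᵢ[ℝ] Eucl n) :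
    (sphereMeasure n).map R = sphereMeasure n := by
  have key : ∀ s : Set (Eucl n), MeasurableSet s → sphereMeasure n s
      = n * volume (Set.Ioo (0 : ℝ) 1 • (s ∩ Metric.sphere (0 : Eucl n) 1)) := by
    intro s hs
    rw [sphereMeasure, Measure.map_apply measurable_subtype_coe hs,
      Measure.toSphere_apply' _ (measurable_subtype_coe hs), Subtype.image_preimage_coe,
      Set.inter_comm]
    simp
  ext s hs
  rw [Measure.map_apply R.continuous.measurable hs, key _ hs,
    key _ (R.continuous.measurable hs),
    ← R.measurePreserving.measure_preimage_emb R.toHomeomorph.measurableEmbedding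
      (Set.Ioo (0 : ℝ) 1 • (s ∩ Metric.sphere (0 : Eucl n) 1))]
  congr 2
  ext x
  simp only [Set.mem_smul, Set.mem_preimage, Set.mem_inter_iff, mem_sphere_zero_iff_norm]
  constructor
  · rintro ⟨r, hr, y, ⟨hy, hy1⟩, rfl⟩
    exact ⟨r, hr, R y, ⟨hy, by simpa using hy1⟩, by simp⟩
  · rintro ⟨r, hr, y, ⟨hy, hy1⟩, hxy⟩
    refine ⟨r, hr, R.symm y, ⟨by simpa using hy, by simpa using hy1⟩, ?_⟩
    rw [← map_smul, hxy, R.symm_apply_apply]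

end Polar

/-! ### The heat kernel on the unit sphere -/

section HeatKernel

variable {n : ℕ}

/-- The Fourier transform `s^(-n/2) exp (-π‖z‖²/s)` of the Gaussian `exp (-πs‖y‖²)`. -/
def heatKernel (s : ℝ) (z : Eucl n) : ℝ := s ^ (-(n : ℝ) / 2) * Real.exp (-Real.pi * ‖z‖ ^ 2 / s)

theorem heatKernel_nonneg {s : ℝ} (hs : 0 < s) (z : Eucl n) : 0 ≤ heatKernel s z := by
  unfold heatKernel; positivity

theorem heatKernel_sub_comm (s : ℝ) (x y : Eucl n) :
    heatKernel s (x - y) = heatKernel s (y - x) := by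
  rw [heatKernel, heatKernel, norm_sub_rev]

theorem heatKernel_le {s : ℝ} (hs : 0 < s) (z : Eucl n) :
    heatKernel s z ≤ s ^ (-(n : ℝ) / 2) := by
  unfold heatKernel
  refine mul_le_of_le_one_right (by positivity) (Real.exp_le_one_iff.2 ?_)
  have : 0 ≤ Real.pi * ‖z‖ ^ 2 / s := by positivity
  linarith [show -Real.pi * ‖z‖ ^ 2 / s = -(Real.pi * ‖z‖ ^ 2 / s) by ring]

@[fun_prop]
theorem continuous_heatKernel (s : ℝ) : Continuous (heatKernel (n := n) s) := by
  unfold heatKernel; fun_prop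

theorem measurable_heatKernel :
    Measurable (fun p : ℝ × Eucl n => heatKernel p.1 p.2) := by
  unfold heatKernel; fun_prop

theorem integrable_exp_neg_mul_sq_norm {b : ℝ} (hb : 0 < b) :
    Integrable (fun x : Eucl n => Real.exp (-b * ‖x‖ ^ 2)) := by
  have := (GaussianFourier.integrable_cexp_neg_mul_sq_norm_add (V := Eucl n)
    (b := (b : ℂ)) (by simpa using hb) 0 0).norm
  refine this.congr (Filter.Eventually.of_forall fun x => ?_)
  simp only [zero_mul, add_zero, Complex.norm_exp]
  congr 1
  rw [← Complex.ofReal_neg, ← Complex.ofReal_pow, ← Complex.ofReal_mul, Complex.ofReal_re]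

theorem lintegral_heatKernel {s : ℝ} (hs : 0 < s) (e : Eucl n) :
    ∫⁻ x : Eucl n, ENNReal.ofReal (heatKernel s (x - e)) = 1 := by
  rw [lintegral_sub_right_eq_self (fun x : Eucl n => ENNReal.ofReal (heatKernel s x)) e]
  have hb : 0 < Real.pi / s := by positivity
  have h := GaussianFourier.integral_rexp_neg_mul_sq_norm (V := Eucl n) hb
  have hfun : ∀ x : Eucl n, heatKernel s x
      = s ^ (-(n : ℝ) / 2) * Real.exp (-(Real.pi / s) * ‖x‖ ^ 2) := by
    intro x; rw [heatKernel]; congr 2; ring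
  rw [← ofReal_integral_eq_lintegral_ofReal]
  · simp_rw [hfun]
    rw [integral_const_mul, h, finrank_euclideanSpace_fin, div_div_cancel₀ Real.pi_pos.ne',
      ← Real.rpow_add hs]
    simp [neg_div]
  · exact ((integrable_exp_neg_mul_sq_norm hb).const_mul _).congr
      (Filter.Eventually.of_forall fun x => (hfun x).symm)
  · exact Filter.Eventually.of_forall fun x => heatKernel_nonneg hs x

/-- The integral over the unit sphere of the heat kernel centred at a point `e`. -/
def sphereHeat (s : ℝ) (e : Eucl n) : ℝ≥0∞ :=
  ∫⁻ θ, ENNReal.ofReal (heatKernel s (e - θ)) ∂(sphereMeasure n)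

theorem sphereHeat_eq_of_norm_eq (s : ℝ) {e e' : Eucl n} (h : ‖e‖ = ‖e'‖) :
    sphereHeat s e = sphereHeat s e' := by
  obtain ⟨R, rfl⟩ := exists_linearIsometryEquiv_apply_eq h
  rw [sphereHeat, sphereHeat]
  conv_rhs => rw [← map_sphereMeasure R]
  rw [lintegral_map (by fun_prop) R.continuous.measurable]
  congr 1 with θ
  rw [← map_sub, heatKernel, heatKernel, R.norm_map]

theorem measurable_sphereHeat (e : Eucl n) : Measurable (fun s => sphereHeat s e) := by
  unfold sphereHeat
  have : Measurable (fun p : ℝ × Eucl n => ENNReal.ofReal (heatKernel p.1 (e - p.2))) := by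
    have := measurable_heatKernel.comp
      (measurable_fst.prodMk (measurable_snd.const_sub e) : Measurable fun p : ℝ × Eucl n =>
        (p.1, e - p.2))
    exact this.ennreal_ofReal
  exact this.lintegral_prod_right'

theorem sphereHeat_le_of_large {s : ℝ} (hs : 0 < s) (e : Eucl n) :
    sphereHeat s e ≤ ENNReal.ofReal (s ^ (-(n : ℝ) / 2)) * sphereMeasure n Set.univ := by
  rw [sphereHeat, ← lintegral_const]
  exact lintegral_mono fun θ => ENNReal.ofReal_le_ofReal (heatKernel_le hs _)

/-- Moving a point of the unit sphere radially inwards by at most `√s / 2` changes the heat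
kernel centred at `e` at most by a constant factor. -/
theorem heatKernel_smul_ge {s r : ℝ} (hs : 0 < s) (hr : 1 - √s / 2 ≤ r)
    (hr1 : r ≤ 1) {θ e : Eucl n} (hθ : ‖θ‖ = 1) (he : ‖e‖ = 1) :
    Real.exp (-Real.pi / 4) * heatKernel s (e - θ) ≤ heatKernel s (r • θ - e) := by
  have h1 : ‖r • θ - e‖ ^ 2 = (r - 1) ^ 2 + r * ‖e - θ‖ ^ 2 := by
    rw [norm_sub_sq_real, norm_sub_sq_real, norm_smul, hθ, he, inner_smul_left,
      real_inner_comm, Real.norm_eq_abs, mul_one, sq_abs]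
    simp
    ring
  have h2 : (r - 1) ^ 2 ≤ s / 4 := by
    have := Real.sq_sqrt hs.le
    nlinarith
  have h3 : ‖r • θ - e‖ ^ 2 ≤ s / 4 + ‖e - θ‖ ^ 2 := by
    rw [h1]
    have := mul_le_of_le_one_left (sq_nonneg ‖e - θ‖) hr1
    linarith
  unfold heatKernel
  rw [mul_left_comm, ← Real.exp_add]
  gcongr
  rw [← sub_nonneg]
  have : -Real.pi * ‖r • θ - e‖ ^ 2 / s - (-Real.pi / 4 + -Real.pi * ‖e - θ‖ ^ 2 / s)
      = Real.pi * (s / 4 + ‖e - θ‖ ^ 2 - ‖r • θ - e‖ ^ 2) / s := by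
    field_simp; ring
  rw [this]
  have := sub_nonneg.2 h3
  positivity

/-- The mass that the heat kernel puts on the sphere is `O(s^(-1/2))`: the kernel has total mass one
on `ℝⁿ`, and it is spread radially over a distance comparable to `√s`. -/
theorem sphereHeat_le_of_small [Nontrivial (Eucl n)] {s : ℝ} (hs : 0 < s) (hs1 : s ≤ 1)
    {e : Eucl n} (he : ‖e‖ = 1) :
    sphereHeat s e ≤ ENNReal.ofReal (2 ^ n * Real.exp (Real.pi / 4) * s ^ (-(1 : ℝ) / 2)) := by
  have hsq : √s ≤ 1 := Real.sqrt_le_one.2 hs1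
  have hsq0 : 0 < √s := Real.sqrt_pos.2 hs
  set c : ℝ := (1 / 2) ^ (n - 1) * Real.exp (-Real.pi / 4)
  have hc : 0 < c := by positivity
  have h1 : ENNReal.ofReal c * sphereHeat s e * ENNReal.ofReal (√s / 2) ≤ 1 := by
    rw [← lintegral_heatKernel hs e, lintegral_eq_polar (by fun_prop)]
    calc _ = ∫⁻ r in Set.Ioo (1 - √s / 2) 1, ENNReal.ofReal c * sphereHeat s e := by
          rw [setLIntegral_const, Real.volume_Ioo, sub_sub_cancel]
      _ ≤ ∫⁻ r in Set.Ioo (1 - √s / 2) 1, ENNReal.ofReal (r ^ (n - 1)) *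
          ∫⁻ θ, ENNReal.ofReal (heatKernel s (r • θ - e)) ∂(sphereMeasure n) := by
          refine setLIntegral_mono' measurableSet_Ioo fun r hr => ?_
          have hr2 : 1 / 2 ≤ r := by linarith [hr.1]
          rw [ENNReal.ofReal_mul (by positivity), mul_assoc]
          gcongr
          rw [sphereHeat, ← lintegral_const_mul _ (by fun_prop)]
          refine lintegral_mono_ae ?_
          filter_upwards [ae_sphereMeasure_norm_eq_one] with θ hθ
          rw [← ENNReal.ofReal_mul (by positivity)]
          exact ENNReal.ofReal_le_ofReal
            (heatKernel_smul_ge hs hr.1.le hr.2.le hθ he)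
      _ ≤ _ := lintegral_mono_set fun r hr => by
          have : 1 / 2 ≤ r := by linarith [hr.1]
          exact Set.mem_Ioi.2 (by linarith)
  have hn : 0 < n := by
    rcases Nat.eq_zero_or_pos n with rfl | h
    · exact absurd (inferInstance : Subsingleton (Eucl 0)) (not_subsingleton _)
    · exact h
  have hprod : (2 ^ n * Real.exp (Real.pi / 4) * s ^ (-(1 : ℝ) / 2)) * (c * (√s / 2)) = 1 := by
    obtain ⟨m, rfl⟩ := Nat.exists_eq_succ_of_ne_zero hn.ne'
    have e1 : Real.exp (Real.pi / 4) * Real.exp (-Real.pi / 4) = 1 := by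
      rw [← Real.exp_add]; simp [neg_div]
    have e2 : s ^ (-(1 : ℝ) / 2) * √s = 1 := by
      rw [Real.sqrt_eq_rpow, ← Real.rpow_add hs]; norm_num
    have e3 : (2 : ℝ) ^ m * (1 / 2) ^ m = 1 := by rw [← mul_pow]; norm_num
    simp only [c, Nat.succ_eq_add_one, Nat.add_sub_cancel, pow_succ]
    calc _ = ((2 : ℝ) ^ m * (1 / 2) ^ m) * (Real.exp (Real.pi / 4) * Real.exp (-Real.pi / 4))
          * (s ^ (-(1 : ℝ) / 2) * √s) := by ring
      _ = 1 := by rw [e1, e2, e3]; norm_num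
  calc sphereHeat s e
      = ENNReal.ofReal (2 ^ n * Real.exp (Real.pi / 4) * s ^ (-(1 : ℝ) / 2)) *
        (ENNReal.ofReal c * sphereHeat s e * ENNReal.ofReal (√s / 2)) := by
        rw [mul_right_comm (ENNReal.ofReal c), ← ENNReal.ofReal_mul hc.le, ← mul_assoc,
          ← ENNReal.ofReal_mul (by positivity), hprod, ENNReal.ofReal_one, one_mul]
    _ ≤ _ := mul_le_of_le_one_right' h1

theorem lintegral_rpow_mul_sphereHeat_lt_top [Nontrivial (Eucl n)] {γ : ℝ} (h₁ : 1 < γ)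
    (h₂ : γ < n) {e : Eucl n} (he : ‖e‖ = 1) :
    ∫⁻ s in Set.Ioi (0 : ℝ), ENNReal.ofReal (s ^ (γ / 2 - 1)) * sphereHeat s e < ∞ := by
  rw [← Set.Ioc_union_Ioi_eq_Ioi (zero_le_one (α := ℝ)),
    lintegral_union measurableSet_Ioi (Set.Ioc_disjoint_Ioi le_rfl)]
  refine ENNReal.add_lt_top.2 ⟨?_, ?_⟩
  · set K := 2 ^ n * Real.exp (Real.pi / 4)
    calc _ ≤ ∫⁻ s in Set.Ioc (0 : ℝ) 1, ENNReal.ofReal (K * s ^ (γ / 2 - 3 / 2)) := by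
          refine setLIntegral_mono' measurableSet_Ioc fun s hs => ?_
          have hs0 : 0 < s := hs.1
          grw [sphereHeat_le_of_small hs.1 hs.2 he]
          rw [← ENNReal.ofReal_mul (by positivity), mul_left_comm, ← Real.rpow_add hs0]
          apply le_of_eq
          congr 3; ring
      _ < ∞ := by
          have := (intervalIntegral.intervalIntegrable_rpow' (a := 0) (b := 1)
            (r := γ / 2 - 3 / 2) (by linarith)).const_mul K
          rw [intervalIntegrable_iff_integrableOn_Ioc_of_le zero_le_one] at this
          exact this.lintegral_lt_top
  · calc _ ≤ ∫⁻ s in Set.Ioi (1 : ℝ), ENNReal.ofReal (s ^ (γ / 2 - 1 - n / 2)) *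
          sphereMeasure n Set.univ := by
          refine setLIntegral_mono' measurableSet_Ioi fun s hs => ?_
          have hs0 : 0 < s := lt_trans zero_lt_one hs
          grw [sphereHeat_le_of_large hs0]
          rw [← mul_assoc, ← ENNReal.ofReal_mul (by positivity), ← Real.rpow_add hs0]
          apply le_of_eq
          congr 3; ring
      _ < ∞ := by
          rw [lintegral_mul_const' _ _ (measure_ne_top _ _)]
          refine ENNReal.mul_lt_top ?_ (measure_lt_top _ _)
          exact (integrableOn_Ioi_rpow_of_lt (by linarith) zero_lt_one).lintegral_lt_top

end HeatKernel

/-! ### The weighted extension estimate for the sphere -/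

section Extension

variable {n : ℕ}

/-- The (inverse) Fourier transform of the measure `h σ`, where `σ` is the surface measure of the
unit sphere. -/
def sphereExtension (h : Eucl n → ℂ) (y : Eucl n) : ℂ :=
  ∫ θ, Complex.exp ((2 * Real.pi * inner ℝ y θ : ℝ) * Complex.I) * h θ ∂(sphereMeasure n)

theorem sphereExtension_congr {h h' : Eucl n → ℂ} (hh : h =ᵐ[sphereMeasure n] h') :
    sphereExtension h = sphereExtension h' := by
  ext y
  refine integral_congr_ae ?_
  filter_upwards [hh] with θ hθ
  rw [hθ]

theorem continuous_sphereExtension {h : Eucl n → ℂ} (hh : Integrable h (sphereMeasure n)) :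
    Continuous (sphereExtension h) := by
  refine continuous_of_dominated (bound := fun θ => ‖h θ‖) ?_ ?_ hh.norm ?_
  · intro y
    exact (by fun_prop : Continuous fun θ : Eucl n =>
      Complex.exp ((2 * Real.pi * inner ℝ y θ : ℝ) * Complex.I)).aestronglyMeasurable.mul hh.1
  · refine fun y => Filter.Eventually.of_forall fun θ => ?_
    rw [norm_mul, Complex.norm_exp_ofReal_mul_I, one_mul]
  · exact Filter.Eventually.of_forall fun θ => by fun_prop

theorem integral_gaussian_mul_exp {s : ℝ} (hs : 0 < s) (z : Eucl n) :
    ∫ y : Eucl n, (Real.exp (-Real.pi * s * ‖y‖ ^ 2) : ℂ)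
      * Complex.exp ((2 * Real.pi * inner ℝ y z : ℝ) * Complex.I) = heatKernel s z := by
  have h := GaussianFourier.integral_cexp_neg_mul_sq_norm_add (V := Eucl n)
    (b := ((Real.pi * s : ℝ) : ℂ)) (by simpa using by positivity) (2 * Real.pi * Complex.I) z
  calc _ = ∫ y : Eucl n, Complex.exp (-((Real.pi * s : ℝ) : ℂ) * (‖y‖ : ℂ) ^ 2
        + 2 * Real.pi * Complex.I * (inner ℝ z y : ℝ)) := by
        congr 1 with y
        rw [Complex.ofReal_exp, ← Complex.exp_add, real_inner_comm]
        congr 1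
        push_cast
        ring
    _ = _ := by
        rw [h, heatKernel]
        have hpi : (Real.pi : ℂ) ≠ 0 := by exact_mod_cast Real.pi_ne_zero
        have hsC : (s : ℂ) ≠ 0 := by exact_mod_cast hs.ne'
        have e1 : (Real.pi : ℂ) / ((Real.pi * s : ℝ) : ℂ) = ((s⁻¹ : ℝ) : ℂ) := by
          push_cast
          field_simp
        have e2 : ((s ^ (-(n : ℝ) / 2) * Real.exp (-Real.pi * ‖z‖ ^ 2 / s) : ℝ) : ℂ)
            = ((s ^ (-(n : ℝ) / 2) : ℝ) : ℂ)
              * Complex.exp ((-Real.pi * ‖z‖ ^ 2 / s : ℝ) : ℂ) := by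
          rw [Complex.ofReal_mul, Complex.ofReal_exp]
        rw [e1, e2]
        congr 1
        · rw [Complex.ofReal_cpow hs.le]
          simp only [finrank_euclideanSpace_fin]
          rw [show ((-(n : ℝ) / 2 : ℝ) : ℂ) = -((n : ℂ) / 2) by push_cast; ring,
            Complex.cpow_neg, ← Complex.inv_cpow]
          · push_cast; rfl
          · rw [Complex.arg_ofReal_of_nonneg hs.le]; exact Real.pi_ne_zero.symm
        · congr 1
          push_cast
          field_simp
          rw [Complex.I_sq]
          ring

/-- The quadratic form of the kernel `heatKernel s (θ - θ')` on the sphere. -/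
def heatForm (s : ℝ) (h : Eucl n → ℂ) : ℂ :=
  ∫ p : Eucl n × Eucl n, h p.1 * (starRingEnd ℂ) (h p.2) * heatKernel s (p.1 - p.2)
    ∂((sphereMeasure n).prod (sphereMeasure n))

theorem lintegral_sphereExtension_mul_gaussian {s : ℝ} (hs : 0 < s) {h : Eucl n → ℂ}
    (hh : Integrable h (sphereMeasure n)) :
    ∫⁻ y, ‖sphereExtension h y‖ₑ ^ 2 * ENNReal.ofReal (Real.exp (-Real.pi * s * ‖y‖ ^ 2))
      = ENNReal.ofReal (heatForm s h).re := by
  set σ := sphereMeasure n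
  set F : Eucl n → Eucl n × Eucl n → ℂ := fun y p =>
    (Real.exp (-Real.pi * s * ‖y‖ ^ 2) : ℂ)
      * Complex.exp ((2 * Real.pi * inner ℝ y (p.1 - p.2) : ℝ) * Complex.I)
      * (h p.1 * (starRingEnd ℂ) (h p.2)) with hF
  have hhh : Integrable (fun p : Eucl n × Eucl n => h p.1 * (starRingEnd ℂ) (h p.2)) (σ.prod σ) :=
    hh.mul_prod (Complex.conjCLE.toContinuousLinearMap.integrable_comp hh)
  have hgauss : Integrable fun y : Eucl n => Real.exp (-Real.pi * s * ‖y‖ ^ 2) := by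
    simpa only [neg_mul] using integrable_exp_neg_mul_sq_norm (n := n) (mul_pos Real.pi_pos hs)
  have hFint : Integrable (Function.uncurry F) (volume.prod (σ.prod σ)) := by
    have hdom := hgauss.ofReal (𝕜 := ℂ) |>.mul_prod hhh
    refine hdom.mono ?_ (Filter.Eventually.of_forall fun q => ?_)
    · have hc : Continuous fun q : Eucl n × (Eucl n × Eucl n) =>
          Complex.exp ((2 * Real.pi * inner ℝ q.1 (q.2.1 - q.2.2) : ℝ) * Complex.I) := by
        fun_prop
      refine (hc.aestronglyMeasurable.mul hdom.1).congr (Filter.Eventually.of_forall fun q => ?_)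
      simp only [Function.uncurry, hF, Pi.mul_apply]
      simp only [RCLike.ofReal_eq_complex_ofReal]
      ring
    · simp only [Function.uncurry, hF, norm_mul, Complex.norm_exp_ofReal_mul_I, mul_one]
      exact le_rfl
  have hinner : ∀ y, ∫ p, F y p ∂(σ.prod σ)
      = ((‖sphereExtension h y‖ ^ 2 * Real.exp (-Real.pi * s * ‖y‖ ^ 2) : ℝ) : ℂ) := by
    intro y
    have h1 : ∀ p : Eucl n × Eucl n, F y p = (Real.exp (-Real.pi * s * ‖y‖ ^ 2) : ℂ) *
        ((Complex.exp ((2 * Real.pi * inner ℝ y p.1 : ℝ) * Complex.I) * h p.1) *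
          (starRingEnd ℂ) (Complex.exp ((2 * Real.pi * inner ℝ y p.2 : ℝ) * Complex.I) *
            h p.2)) := by
      intro p
      have : Complex.exp ((2 * Real.pi * inner ℝ y (p.1 - p.2) : ℝ) * Complex.I)
          = Complex.exp ((2 * Real.pi * inner ℝ y p.1 : ℝ) * Complex.I) *
            (starRingEnd ℂ) (Complex.exp ((2 * Real.pi * inner ℝ y p.2 : ℝ) * Complex.I)) := by
        rw [← Complex.exp_conj, ← Complex.exp_add]
        congr 1
        rw [map_mul, Complex.conj_ofReal, Complex.conj_I, inner_sub_right]
        push_cast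
        ring
      simp only [hF]
      rw [this, map_mul]
      ring
    simp_rw [h1]
    rw [integral_const_mul, integral_prod_mul (μ := σ) (ν := σ)
      (fun θ => Complex.exp ((2 * Real.pi * inner ℝ y θ : ℝ) * Complex.I) * h θ)
      (fun θ => (starRingEnd ℂ)
        (Complex.exp ((2 * Real.pi * inner ℝ y θ : ℝ) * Complex.I) * h θ)), integral_conj]
    change _ * (sphereExtension h y * (starRingEnd ℂ) (sphereExtension h y)) = _
    rw [Complex.mul_conj, Complex.normSq_eq_norm_sq]
    push_cast
    ring
  have hswap : ∫ y, ∫ p, F y p ∂(σ.prod σ) = heatForm s h := by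
    rw [integral_integral_swap hFint, heatForm]
    congr 1 with p
    simp only [hF]
    rw [integral_mul_const, integral_gaussian_mul_exp hs, mul_comm]
  have hintR : Integrable (fun y => ‖sphereExtension h y‖ ^ 2
      * Real.exp (-Real.pi * s * ‖y‖ ^ 2)) := by
    have := hFint.integral_prod_left.re
    refine this.congr (Filter.Eventually.of_forall fun y => ?_)
    change (∫ p, F y p ∂(σ.prod σ)).re = _
    rw [hinner, Complex.ofReal_re]
  have hval : ∫ y, ‖sphereExtension h y‖ ^ 2 * Real.exp (-Real.pi * s * ‖y‖ ^ 2)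
      = (heatForm s h).re := by
    rw [← hswap]
    simp_rw [hinner]
    rw [integral_complex_ofReal, Complex.ofReal_re]
  rw [← hval, ofReal_integral_eq_lintegral_ofReal hintR
    (Filter.Eventually.of_forall fun y => by positivity)]
  congr 1 with y
  rw [ENNReal.ofReal_mul (by positivity), ENNReal.ofReal_pow (by positivity), ofReal_norm]

/-- The Schur test for the positive kernel `heatKernel s (θ - θ')`, whose integral in `θ'` does
not depend on the point `θ` of the sphere. -/
theorem enorm_heatForm_le {s : ℝ} (hs : 0 < s) {e : Eucl n} (he : ‖e‖ = 1) {h : Eucl n → ℂ}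
    (hh : AEStronglyMeasurable h (sphereMeasure n)) :
    ‖heatForm s h‖ₑ ≤ sphereHeat s e * ∫⁻ θ, ‖h θ‖ₑ ^ 2 ∂(sphereMeasure n) := by
  set σ := sphereMeasure n
  have hm : AEMeasurable (fun θ => ‖h θ‖ₑ ^ 2) σ := hh.enorm.pow_const _
  set k : Eucl n → Eucl n → ℝ≥0∞ := fun θ θ' => ENNReal.ofReal (heatKernel s (θ - θ'))
  have hk : Measurable (Function.uncurry k) := by
    simp only [k, Function.uncurry_def]; fun_prop
  have hk' : ∀ θ, Measurable (k θ) := fun θ => by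
    change Measurable fun θ' => ENNReal.ofReal (heatKernel s (θ - θ'))
    fun_prop
  have hk1 : ∀ᵐ θ ∂σ, ∫⁻ θ', k θ θ' ∂σ = sphereHeat s e := by
    filter_upwards [ae_sphereMeasure_norm_eq_one] with θ hθ
    exact sphereHeat_eq_of_norm_eq s (hθ.trans he.symm)
  have key : ∫⁻ θ, ∫⁻ θ', ‖h θ‖ₑ ^ 2 / 2 * k θ θ' ∂σ ∂σ
      = sphereHeat s e * (∫⁻ θ, ‖h θ‖ₑ ^ 2 ∂σ) / 2 := by
    calc _ = ∫⁻ θ, ‖h θ‖ₑ ^ 2 * (sphereHeat s e / 2) ∂σ := by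
          refine lintegral_congr_ae ?_
          filter_upwards [hk1] with θ hθ
          rw [lintegral_const_mul _ (hk' θ), hθ, div_eq_mul_inv,
            div_eq_mul_inv, mul_assoc, mul_comm (2⁻¹ : ℝ≥0∞)]
      _ = _ := by
          rw [lintegral_mul_const'' _ hm, mul_comm, div_eq_mul_inv, div_eq_mul_inv,
            mul_right_comm]
  have hm1 : AEMeasurable (fun p : Eucl n × Eucl n => ‖h p.1‖ₑ ^ 2 / 2 * k p.1 p.2)
      (σ.prod σ) :=
    ((hm.div_const 2).comp_fst).mul hk.aemeasurable
  have hm2 : AEMeasurable (fun p : Eucl n × Eucl n => ‖h p.2‖ₑ ^ 2 / 2 * k p.1 p.2)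
      (σ.prod σ) :=
    ((hm.div_const 2).comp_snd).mul hk.aemeasurable
  calc ‖heatForm s h‖ₑ
      ≤ ∫⁻ p, ‖h p.1 * (starRingEnd ℂ) (h p.2) * heatKernel s (p.1 - p.2)‖ₑ ∂(σ.prod σ) :=
        enorm_integral_le_lintegral_enorm _
    _ ≤ ∫⁻ p, (‖h p.1‖ₑ ^ 2 / 2 * k p.1 p.2 + ‖h p.2‖ₑ ^ 2 / 2 * k p.1 p.2) ∂(σ.prod σ) := by
        refine lintegral_mono fun p => ?_
        have h1 : ‖(heatKernel s (p.1 - p.2) : ℂ)‖ₑ = k p.1 p.2 := by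
          rw [← ofReal_norm, Complex.norm_real, Real.norm_of_nonneg (heatKernel_nonneg hs _)]
        have h2 : ‖(starRingEnd ℂ) (h p.2)‖ₑ = ‖h p.2‖ₑ := by
          rw [← ofReal_norm, RCLike.norm_conj, ofReal_norm]
        rw [enorm_mul, enorm_mul, h1, h2, ← add_mul]
        gcongr
        have := ENNReal.young_inequality ‖h p.1‖ₑ ‖h p.2‖ₑ Real.HolderConjugate.two_two
        simpa using this
    _ = sphereHeat s e * ∫⁻ θ, ‖h θ‖ₑ ^ 2 ∂σ := by
        rw [lintegral_add_left' hm1, lintegral_prod _ hm1, lintegral_prod_symm _ hm2, key]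
        have : ∫⁻ θ', ∫⁻ θ, ‖h θ'‖ₑ ^ 2 / 2 * k θ θ' ∂σ ∂σ
            = ∫⁻ θ, ∫⁻ θ', ‖h θ‖ₑ ^ 2 / 2 * k θ θ' ∂σ ∂σ := by
          simp only [k, heatKernel_sub_comm]
        rw [this, key, ENNReal.add_halves]

theorem ofReal_re_heatForm_const {s : ℝ} (hs : 0 < s) {e : Eucl n} (he : ‖e‖ = 1) (c : ℂ) :
    ENNReal.ofReal (heatForm s (fun _ : Eucl n => c)).re
      = sphereHeat s e * ∫⁻ _, ‖c‖ₑ ^ 2 ∂(sphereMeasure n) := by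
  set σ := sphereMeasure n
  have h1 : heatForm s (fun _ : Eucl n => c)
      = ((‖c‖ ^ 2 * ∫ p : Eucl n × Eucl n, heatKernel s (p.1 - p.2) ∂(σ.prod σ) : ℝ) : ℂ) := by
    rw [heatForm, integral_const_mul, integral_complex_ofReal, Complex.mul_conj,
      Complex.normSq_eq_norm_sq]
    push_cast; rfl
  have hk : Continuous fun p : Eucl n × Eucl n => heatKernel s (p.1 - p.2) := by fun_prop
  have hint : Integrable (fun p : Eucl n × Eucl n => heatKernel s (p.1 - p.2)) (σ.prod σ) := by
    refine Integrable.of_bound hk.aestronglyMeasurable (s ^ (-(n : ℝ) / 2))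
      (Filter.Eventually.of_forall fun p => ?_)
    rw [Real.norm_of_nonneg (heatKernel_nonneg hs _)]
    exact heatKernel_le hs _
  rw [h1, Complex.ofReal_re, ENNReal.ofReal_mul (by positivity),
    ofReal_integral_eq_lintegral_ofReal hint
      (Filter.Eventually.of_forall fun p => heatKernel_nonneg hs _),
    lintegral_prod _ (by fun_prop), lintegral_const, ENNReal.ofReal_pow (by positivity),
    ofReal_norm]
  have : ∫⁻ θ, ∫⁻ θ', ENNReal.ofReal (heatKernel s (θ - θ')) ∂σ ∂σ
      = sphereHeat s e * σ Set.univ := by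
    rw [← lintegral_const]
    refine lintegral_congr_ae ?_
    filter_upwards [ae_sphereMeasure_norm_eq_one] with θ hθ
    exact sphereHeat_eq_of_norm_eq s (hθ.trans he.symm)
  rw [this]
  ring

/-- The constant in the subordination formula
`∫ s^(γ/2-1) exp (-πs r²) ds = c r^(-γ)`. -/
def subordinationConst (γ : ℝ) : ℝ := Real.pi ^ (-(γ / 2)) * Real.Gamma (γ / 2)

theorem subordinationConst_pos {γ : ℝ} (hγ : 0 < γ) : 0 < subordinationConst γ := by
  have := Real.Gamma_pos_of_pos (half_pos hγ)
  unfold subordinationConst; positivity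

theorem lintegral_rpow_mul_gaussian {γ : ℝ} (hγ : 0 < γ) {r : ℝ} (hr : 0 < r) :
    ∫⁻ s in Set.Ioi (0 : ℝ), ENNReal.ofReal (s ^ (γ / 2 - 1))
      * ENNReal.ofReal (Real.exp (-Real.pi * s * r ^ 2))
      = ENNReal.ofReal (subordinationConst γ) * ENNReal.ofReal (r ^ (-γ)) := by
  have hp : 0 < Real.pi * r ^ 2 := by positivity
  have h := Real.integral_rpow_mul_exp_neg_mul_Ioi (half_pos hγ) hp
  have hint : IntegrableOn (fun s : ℝ => s ^ (γ / 2 - 1) * Real.exp (-(Real.pi * r ^ 2 * s)))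
      (Set.Ioi 0) := by
    by_contra hcon
    rw [integral_undef hcon] at h
    have := Real.Gamma_pos_of_pos (half_pos hγ)
    have : 0 < (1 / (Real.pi * r ^ 2)) ^ (γ / 2) * Real.Gamma (γ / 2) := by positivity
    linarith
  calc _ = ∫⁻ s in Set.Ioi (0 : ℝ),
        ENNReal.ofReal (s ^ (γ / 2 - 1) * Real.exp (-(Real.pi * r ^ 2 * s))) := by
        refine setLIntegral_congr_fun measurableSet_Ioi fun s hs => ?_
        have hs : (0 : ℝ) < s := hs
        rw [← ENNReal.ofReal_mul (by positivity)]
        congr 3; ring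
    _ = _ := by
        rw [← ofReal_integral_eq_lintegral_ofReal hint, h, subordinationConst,
          ← ENNReal.ofReal_mul (by have := Real.Gamma_pos_of_pos (half_pos hγ); positivity)]
        · congr 1
          have : (1 / (Real.pi * r ^ 2)) ^ (γ / 2) = Real.pi ^ (-(γ / 2)) * r ^ (-γ) := by
            rw [one_div, Real.inv_rpow hp.le, ← Real.rpow_neg hp.le,
              Real.mul_rpow Real.pi_pos.le (by positivity), ← Real.rpow_natCast r 2,
              ← Real.rpow_mul hr.le]
            congr 2; push_cast; ring
          rw [this]; ring
        · filter_upwards [ae_restrict_mem measurableSet_Ioi] with s hs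
          have hs : (0 : ℝ) < s := hs
          positivity

/-- The best constant in the weighted extension estimate `lintegral_weight_sphereExtension_le`;
the point `e` is any point of the unit sphere. -/
def extensionConst (γ : ℝ) (e : Eucl n) : ℝ≥0∞ :=
  (ENNReal.ofReal (subordinationConst γ))⁻¹ *
    ∫⁻ s in Set.Ioi (0 : ℝ), ENNReal.ofReal (s ^ (γ / 2 - 1)) * sphereHeat s e

theorem measurable_rpow_mul_sphereHeat (γ : ℝ) (e : Eucl n) :
    Measurable fun s : ℝ => ENNReal.ofReal (s ^ (γ / 2 - 1)) * sphereHeat s e :=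
  (by fun_prop : Measurable fun s : ℝ => ENNReal.ofReal (s ^ (γ / 2 - 1))).mul
    (measurable_sphereHeat e)

theorem extensionConst_lt_top [Nontrivial (Eucl n)] {γ : ℝ} (h₁ : 1 < γ) (h₂ : γ < n)
    {e : Eucl n} (he : ‖e‖ = 1) : extensionConst γ e < ∞ := by
  refine ENNReal.mul_lt_top ?_ (lintegral_rpow_mul_sphereHeat_lt_top h₁ h₂ he)
  have := subordinationConst_pos (γ := γ) (by linarith)
  simpa using this

theorem lintegral_weight_sphereExtension_eq [Nontrivial (Eucl n)] {γ : ℝ} (hγ : 0 < γ)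
    {h : Eucl n → ℂ} (hh : Integrable h (sphereMeasure n)) :
    ∫⁻ y, ENNReal.ofReal (‖y‖ ^ (-γ)) * ‖sphereExtension h y‖ₑ ^ 2
      = (ENNReal.ofReal (subordinationConst γ))⁻¹ * ∫⁻ s in Set.Ioi (0 : ℝ),
        ENNReal.ofReal (s ^ (γ / 2 - 1)) * ENNReal.ofReal (heatForm s h).re := by
  have hc := subordinationConst_pos hγ
  have hcont := continuous_sphereExtension hh
  have hne : ∀ᵐ y : Eucl n, y ≠ 0 := by simp [ae_iff]
  calc _ = ∫⁻ y : Eucl n, ∫⁻ s in Set.Ioi (0 : ℝ), (ENNReal.ofReal (subordinationConst γ))⁻¹ *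
        (ENNReal.ofReal (s ^ (γ / 2 - 1)) * (‖sphereExtension h y‖ₑ ^ 2 *
          ENNReal.ofReal (Real.exp (-Real.pi * s * ‖y‖ ^ 2)))) := by
        refine lintegral_congr_ae ?_
        filter_upwards [hne] with y hy
        have hy0 : 0 < ‖y‖ := norm_pos_iff.2 hy
        have h1 := lintegral_rpow_mul_gaussian hγ hy0
        have h2 : ENNReal.ofReal (‖y‖ ^ (-γ)) = (ENNReal.ofReal (subordinationConst γ))⁻¹ *
            ∫⁻ s in Set.Ioi (0 : ℝ), ENNReal.ofReal (s ^ (γ / 2 - 1))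
              * ENNReal.ofReal (Real.exp (-Real.pi * s * ‖y‖ ^ 2)) := by
          rw [h1, ← mul_assoc, ENNReal.inv_mul_cancel (by simpa using hc) ENNReal.ofReal_ne_top,
            one_mul]
        rw [h2, mul_assoc, ← lintegral_mul_const _ (by fun_prop),
          ← lintegral_const_mul _ (by fun_prop)]
        congr 1 with s
        ring
    _ = _ := by
        rw [lintegral_lintegral_swap, ← lintegral_const_mul']
        · refine setLIntegral_congr_fun measurableSet_Ioi fun s hs => ?_
          rw [← lintegral_sphereExtension_mul_gaussian hs hh, ← lintegral_const_mul,
            ← lintegral_const_mul]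
          · fun_prop
          · fun_prop
        · simpa using hc
        · simp only [Function.uncurry_def]
          fun_prop

/-- The weighted estimate for the Fourier transform of a measure on the sphere. -/
theorem lintegral_weight_sphereExtension_le [Nontrivial (Eucl n)] {γ : ℝ} (hγ : 0 < γ)
    {e : Eucl n} (he : ‖e‖ = 1) {h : Eucl n → ℂ} (hh : Integrable h (sphereMeasure n)) :
    ∫⁻ y, ENNReal.ofReal (‖y‖ ^ (-γ)) * ‖sphereExtension h y‖ₑ ^ 2
      ≤ extensionConst γ e * ∫⁻ θ, ‖h θ‖ₑ ^ 2 ∂(sphereMeasure n) := by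
  rw [lintegral_weight_sphereExtension_eq hγ hh, extensionConst, mul_assoc]
  gcongr
  rw [← lintegral_mul_const _ (measurable_rpow_mul_sphereHeat γ e)]
  refine setLIntegral_mono' measurableSet_Ioi fun s hs => ?_
  rw [mul_assoc]
  gcongr
  refine le_trans ?_ (enorm_heatForm_le hs he hh.1)
  rw [← ofReal_norm]
  exact ENNReal.ofReal_le_ofReal (Complex.re_le_norm _)

/-- Constant functions on the sphere give equality. -/
theorem lintegral_weight_sphereExtension_of_ae_const [Nontrivial (Eucl n)] {γ : ℝ} (hγ : 0 < γ)
    {e : Eucl n} (he : ‖e‖ = 1) {h : Eucl n → ℂ} {c : ℂ}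
    (hh : h =ᵐ[sphereMeasure n] fun _ => c) :
    ∫⁻ y, ENNReal.ofReal (‖y‖ ^ (-γ)) * ‖sphereExtension h y‖ₑ ^ 2
      = extensionConst γ e * ∫⁻ θ, ‖h θ‖ₑ ^ 2 ∂(sphereMeasure n) := by
  rw [sphereExtension_congr hh, lintegral_weight_sphereExtension_eq hγ (integrable_const c),
    extensionConst, mul_assoc]
  have h1 : ∫⁻ θ, ‖h θ‖ₑ ^ 2 ∂(sphereMeasure n) = ∫⁻ _, ‖c‖ₑ ^ 2 ∂(sphereMeasure n) := by
    refine lintegral_congr_ae ?_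
    filter_upwards [hh] with θ hθ
    rw [hθ]
  congr 1
  rw [h1, ← lintegral_mul_const _ (measurable_rpow_mul_sphereHeat γ e)]
  refine setLIntegral_congr_fun measurableSet_Ioi fun s hs => ?_
  rw [ofReal_re_heatForm_const hs he, mul_assoc]

end Extension

/-! ### Plancherel's theorem in the time variable -/

section TimeFrequency

/-- The radius `(2πλ)^(1/β) / (2π)` of the sphere on which `(2π‖ξ‖)^β = 2πλ`. -/
def frequencyRadius (β l : ℝ) : ℝ := (2 * Real.pi * l) ^ (1 / β) / (2 * Real.pi)

/-- The derivative of `frequencyRadius`. -/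
def frequencyRadiusDeriv (β l : ℝ) : ℝ := 1 / β * (2 * Real.pi * l) ^ (1 / β - 1)

variable {β : ℝ}

theorem frequencyRadius_pos {l : ℝ} (hl : 0 < l) : 0 < frequencyRadius β l := by
  unfold frequencyRadius; positivity

theorem rpow_frequencyRadius (hβ : β ≠ 0) {l : ℝ} (hl : 0 < l) :
    (2 * Real.pi * frequencyRadius β l) ^ β = 2 * Real.pi * l := by
  rw [frequencyRadius, mul_div_cancel₀ _ (by positivity), ← Real.rpow_mul (by positivity),
    one_div_mul_cancel hβ, Real.rpow_one]

theorem hasDerivAt_frequencyRadius {l : ℝ} (hl : 0 < l) :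
    HasDerivAt (frequencyRadius β) (frequencyRadiusDeriv β l) l := by
  have h1 : HasDerivAt (fun l : ℝ => 2 * Real.pi * l) (2 * Real.pi) l := by
    simpa using (hasDerivAt_id l).const_mul (2 * Real.pi)
  have h2 := (h1.rpow_const (p := 1 / β) (Or.inl (by positivity))).div_const (2 * Real.pi)
  refine h2.congr_deriv ?_
  rw [frequencyRadiusDeriv]
  field_simp

theorem injOn_frequencyRadius (hβ : β ≠ 0) : Set.InjOn (frequencyRadius β) (Set.Ioi 0) := by
  intro l hl l' hl' h
  have h1 := rpow_frequencyRadius hβ hl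
  rw [h, rpow_frequencyRadius hβ hl'] at h1
  exact (mul_left_cancel₀ (by positivity) h1).symm

theorem image_frequencyRadius (hβ : β ≠ 0) :
    frequencyRadius β '' Set.Ioi 0 = Set.Ioi 0 := by
  apply Set.Subset.antisymm
  · rintro _ ⟨l, hl, rfl⟩
    exact frequencyRadius_pos hl
  · intro r hr
    have hr : 0 < r := hr
    refine ⟨(2 * Real.pi * r) ^ β / (2 * Real.pi), ?_, ?_⟩
    · exact Set.mem_Ioi.2 (by positivity)
    · rw [frequencyRadius, mul_div_cancel₀ _ (by positivity), ← Real.rpow_mul (by positivity),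
        mul_one_div_cancel hβ, Real.rpow_one, mul_div_cancel_left₀ _ (by positivity)]

/-- The density of the radius with respect to the time frequency `(2πr)^β / (2π)`. -/
def frequencyDensity (β r : ℝ) : ℝ := (2 * Real.pi * r) ^ (1 - β) / |β|

@[fun_prop]
theorem measurable_frequencyDensity : Measurable (frequencyDensity β) := by
  unfold frequencyDensity; fun_prop

theorem frequencyDensity_frequencyRadius (hβ : β ≠ 0) {l : ℝ} (hl : 0 < l) :
    frequencyDensity β (frequencyRadius β l) = |frequencyRadiusDeriv β l| := by
  rw [frequencyDensity, frequencyRadius, mul_div_cancel₀ _ (by positivity),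
    ← Real.rpow_mul (by positivity), frequencyRadiusDeriv, abs_mul,
    abs_of_nonneg (by positivity : 0 ≤ (2 * Real.pi * l) ^ (1 / β - 1)), abs_div, abs_one,
    show 1 / β * (1 - β) = 1 / β - 1 by field_simp]
  ring

/-- Plancherel's theorem in the time variable, for a superposition of the oscillations
`exp (-it(2πr)^β)`, `r > 0`. -/
theorem lintegral_enorm_sq_integral_oscillation (hβ : β ≠ 0) {H : ℝ → ℂ}
    (hH : IntegrableOn H (Set.Ioi 0))
    (hH2 : ∫⁻ r in Set.Ioi (0 : ℝ), ‖H r‖ₑ ^ 2 * ENNReal.ofReal (frequencyDensity β r) < ∞) :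
    ∫⁻ t : ℝ, ‖∫ r in Set.Ioi (0 : ℝ),
        Complex.exp (-(t * (2 * Real.pi * r) ^ β : ℝ) * Complex.I) * H r‖ₑ ^ 2
      = ∫⁻ r in Set.Ioi (0 : ℝ), ‖H r‖ₑ ^ 2 * ENNReal.ofReal (frequencyDensity β r) := by
  set J : ℝ → ℂ := (Set.Ioi (0 : ℝ)).indicator fun l =>
    |frequencyRadiusDeriv β l| • H (frequencyRadius β l) with hJ
  have hderiv : ∀ l ∈ Set.Ioi (0 : ℝ), HasDerivWithinAt (frequencyRadius β)
      (frequencyRadiusDeriv β l) (Set.Ioi 0) l := fun l hl =>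
    (hasDerivAt_frequencyRadius hl).hasDerivWithinAt
  have hJint : Integrable J := by
    rw [hJ, integrable_indicator_iff measurableSet_Ioi,
      ← integrableOn_image_iff_integrableOn_abs_deriv_smul measurableSet_Ioi hderiv
        (injOn_frequencyRadius hβ), image_frequencyRadius hβ]
    exact hH
  have hJ2 : ∫⁻ l, ‖J l‖ₑ ^ 2
      = ∫⁻ r in Set.Ioi (0 : ℝ), ‖H r‖ₑ ^ 2 * ENNReal.ofReal (frequencyDensity β r) := by
    conv_rhs => rw [← image_frequencyRadius hβ]
    rw [lintegral_image_eq_lintegral_abs_deriv_mul measurableSet_Ioi hderiv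
      (injOn_frequencyRadius hβ), ← lintegral_indicator measurableSet_Ioi]
    congr 1 with l
    by_cases hl : l ∈ Set.Ioi (0 : ℝ)
    · rw [hJ, Set.indicator_of_mem hl, Set.indicator_of_mem hl,
        frequencyDensity_frequencyRadius hβ hl, enorm_smul, ← ofReal_norm, Real.norm_eq_abs,
        abs_abs]
      ring
    · rw [hJ, Set.indicator_of_notMem hl, Set.indicator_of_notMem hl]
      simp
  have hJm : MemLp J 2 volume := by
    refine ⟨hJint.1, ?_⟩
    rw [← hJ2, lintegral_enorm_sq_eq_eLpNorm] at hH2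
    by_contra hcon
    rw [not_lt_top_iff] at hcon
    simp [hcon] at hH2
  rw [← hJ2, ← lintegral_enorm_fourier_sq hJint hJm]
  congr 1 with t
  congr 2
  rw [Real.fourier_real_eq_integral_exp_smul]
  conv_lhs => rw [← image_frequencyRadius hβ]
  rw [integral_image_eq_integral_abs_deriv_smul measurableSet_Ioi hderiv
    (injOn_frequencyRadius hβ), ← integral_indicator measurableSet_Ioi]
  congr 1 with l
  by_cases hl : l ∈ Set.Ioi (0 : ℝ)
  · rw [hJ, Set.indicator_of_mem hl, Set.indicator_of_mem hl, rpow_frequencyRadius hβ hl,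
      smul_comm, smul_eq_mul]
    congr 4
    push_cast
    ring
  · rw [hJ, Set.indicator_of_notMem hl, Set.indicator_of_notMem hl, smul_zero]

end TimeFrequency

/-! ### The estimate for frequencies in an annulus -/

section FreeGradient

variable {n : ℕ} {α β γ : ℝ}

/-- The function `|∇|^α φ (t, x)` for the solution `φ` with initial datum `𝓕⁻ g`, given by an
absolutely convergent integral if `g` is integrable and supported in an annulus. -/
def freeGrad (α β : ℝ) (g : Eucl n → ℂ) (p : ℝ × Eucl n) : ℂ :=
  𝓕⁻ (fun ξ => (gradSymbol α ξ : ℂ) * evolutionSymbol β p.1 ξ * g ξ) p.2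

theorem freeGrad_eq_integral (g : Eucl n → ℂ) (p : ℝ × Eucl n) :
    freeGrad α β g p = ∫ ξ : Eucl n, Complex.exp ((2 * Real.pi * inner ℝ ξ p.2 : ℝ) * Complex.I)
      * ((gradSymbol α ξ : ℂ) * evolutionSymbol β p.1 ξ * g ξ) := by
  rw [freeGrad, Real.fourierInv_eq']
  simp only [smul_eq_mul]

theorem rpow_le_add_of_mem_Icc {a b r : ℝ} (ha : 0 < a) (h1 : a ≤ r) (h2 : r ≤ b) (s : ℝ) :
    r ^ s ≤ a ^ s + b ^ s := by
  have hr : 0 < r := ha.trans_le h1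
  have hb : 0 < b := hr.trans_le h2
  rcases le_total 0 s with hs | hs
  · have := Real.rpow_le_rpow hr.le h2 hs
    have : 0 ≤ a ^ s := by positivity
    linarith
  · have := Real.rpow_le_rpow_of_nonpos ha h1 hs
    have : 0 ≤ b ^ s := by positivity
    linarith

/-- The function is supported in the annulus `a ≤ ‖ξ‖ ≤ b`. -/
def SupportedInAnnulus (a b : ℝ) (g : Eucl n → ℂ) : Prop :=
  ∀ ξ, g ξ ≠ 0 → a ≤ ‖ξ‖ ∧ ‖ξ‖ ≤ b

theorem MeasureTheory.MemLp.integrable_of_supportedInAnnulus {a b : ℝ} {g : Eucl n → ℂ}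
    (hg : MemLp g 2 volume) (hs : SupportedInAnnulus a b g) : Integrable g := by
  have h1 : IntegrableOn g (Metric.closedBall 0 b) := by
    have : IsFiniteMeasure (volume.restrict (Metric.closedBall (0 : Eucl n) b)) :=
      ⟨by simpa using measure_closedBall_lt_top⟩
    exact (hg.restrict _).integrable (by norm_num)
  refine (integrableOn_iff_integrable_of_support_subset ?_).1 h1
  intro ξ hξ
  simpa using (hs ξ hξ).2

theorem integrable_gradSymbol_mul {a b : ℝ} (ha : 0 < a) {g : Eucl n → ℂ}
    (hg : Integrable g) (hs : SupportedInAnnulus a b g) (t : ℝ) :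
    Integrable (fun ξ => (gradSymbol α ξ : ℂ) * evolutionSymbol β t ξ * g ξ) := by
  have hm : AEStronglyMeasurable
      (fun ξ : Eucl n => (gradSymbol α ξ : ℂ) * evolutionSymbol β t ξ) volume :=
    ((Complex.measurable_ofReal.comp (measurable_gradSymbol α)).mul
      (measurable_evolutionSymbol β t)).aestronglyMeasurable
  refine (hg.norm.const_mul ((2 * Real.pi * a) ^ α + (2 * Real.pi * b) ^ α)).mono'
    (hm.mul hg.1) (Filter.Eventually.of_forall fun ξ => ?_)
  rw [norm_mul, norm_mul, norm_evolutionSymbol, mul_one, Complex.norm_real,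
    Real.norm_of_nonneg (gradSymbol_nonneg α ξ)]
  by_cases hξ : g ξ = 0
  · simp [hξ]
  · gcongr
    obtain ⟨h1, h2⟩ := hs ξ hξ
    exact rpow_le_add_of_mem_Icc (by positivity) (by gcongr) (by gcongr) α

theorem measurable_freeGrad {g : Eucl n → ℂ} (hg : Measurable g) :
    Measurable (freeGrad α β g) := by
  have h : StronglyMeasurable (fun q : (ℝ × Eucl n) × Eucl n =>
      Complex.exp ((2 * Real.pi * inner ℝ q.2 q.1.2 : ℝ) * Complex.I)
        * ((gradSymbol α q.2 : ℂ) * evolutionSymbol β q.1.1 q.2 * g q.2)) := by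
    refine Measurable.stronglyMeasurable ?_
    unfold evolutionSymbol gradSymbol
    fun_prop
  have := h.integral_prod_right' (ν := (volume : Measure (Eucl n)))
  rw [funext (freeGrad_eq_integral (α := α) (β := β) g)]
  exact this.measurable

theorem weightedNormSq_eq (γ : ℝ) (u : ℝ × Eucl n → ℂ) :
    weightedNormSq γ u
      = ∫⁻ t : ℝ, ∫⁻ x : Eucl n, ENNReal.ofReal (‖x‖ ^ (-γ)) * ‖u (t, x)‖ₑ ^ 2 := by
  unfold weightedNormSq
  congr 1 with t
  congr 1 with x
  rw [div_eq_inv_mul, ← Real.rpow_neg (norm_nonneg x), ENNReal.ofReal_mul (by positivity),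
    ENNReal.ofReal_pow (by positivity), ofReal_norm]

/-- The contribution of the sphere of radius `r` to `|∇|^α φ (0, x)`. -/
def radialProfile (α : ℝ) (g : Eucl n → ℂ) (x : Eucl n) (r : ℝ) : ℂ :=
  ((r ^ (n - 1) * (2 * Real.pi * r) ^ α : ℝ) : ℂ) *
    sphereExtension (fun θ => g (r • θ)) (r • x)

theorem integrableOn_polar [Nontrivial (Eucl n)] {f : Eucl n → ℂ} (hf : Integrable f) :
    IntegrableOn (fun r : ℝ => ((r ^ (n - 1) : ℝ) : ℂ) * ∫ θ, f (r • θ) ∂(sphereMeasure n))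
      (Set.Ioi 0) := by
  have hmp := measurePreserving_smul_sphereMeasure_prod (n := n)
  have hint : Integrable (fun p : Eucl n × ℝ => f (p.2 • p.1))
    ((sphereMeasure n).prod (radialMeasure n)) :=
    (hmp.integrable_comp hf.aestronglyMeasurable).2 hf
  have h := hint.integral_prod_right
  have hd : (fun r : ℝ => ENNReal.ofReal (r ^ (n - 1)))
      = fun r => ((Real.toNNReal (r ^ (n - 1)) : ℝ≥0) : ℝ≥0∞) := rfl
  rw [radialMeasure, hd, integrable_withDensity_iff_integrable_smul (by fun_prop)] at h
  refine IntegrableOn.congr_fun h (fun r hr => ?_) measurableSet_Ioi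
  have hr : (0 : ℝ) < r := hr
  simp only [NNReal.smul_def, Complex.real_smul]
  rw [Real.coe_toNNReal _ (by positivity)]

theorem ae_integrable_sphereMeasure [Nontrivial (Eucl n)] {f : Eucl n → ℂ}
    (hf : Integrable f) :
    ∀ᵐ r ∂(volume.restrict (Set.Ioi (0 : ℝ))),
      Integrable (fun θ => f (r • θ)) (sphereMeasure n) := by
  have hmp := measurePreserving_smul_sphereMeasure_prod (n := n)
  have hint : Integrable (fun p : Eucl n × ℝ => f (p.2 • p.1))
    ((sphereMeasure n).prod (radialMeasure n)) :=
    (hmp.integrable_comp hf.aestronglyMeasurable).2 hf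
  have h := hint.prod_left_ae
  rw [radialMeasure, ae_withDensity_iff (by fun_prop)] at h
  filter_upwards [h, ae_restrict_mem measurableSet_Ioi] with r hr hr0
  have hr0 : (0 : ℝ) < r := hr0
  exact hr (by simpa using by positivity)

theorem sphere_integral_eq_radialProfile (g : Eucl n → ℂ) (t : ℝ) (x : Eucl n) {r : ℝ}
    (hr : 0 < r) :
    ((r ^ (n - 1) : ℝ) : ℂ) * ∫ θ, Complex.exp ((2 * Real.pi * inner ℝ (r • θ) x : ℝ) * Complex.I)
      * ((gradSymbol α (r • θ) : ℂ) * evolutionSymbol β t (r • θ) * g (r • θ)) ∂(sphereMeasure n)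
    = Complex.exp (-(t * (2 * Real.pi * r) ^ β : ℝ) * Complex.I) * radialProfile α g x r := by
  have h : ∫ θ, Complex.exp ((2 * Real.pi * inner ℝ (r • θ) x : ℝ) * Complex.I)
      * ((gradSymbol α (r • θ) : ℂ) * evolutionSymbol β t (r • θ) * g (r • θ)) ∂(sphereMeasure n)
      = ((2 * Real.pi * r) ^ α : ℝ) * Complex.exp (-(t * (2 * Real.pi * r) ^ β : ℝ) * Complex.I) *
        sphereExtension (fun θ => g (r • θ)) (r • x) := by
    rw [sphereExtension, ← integral_const_mul]
    refine integral_congr_ae ?_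
    filter_upwards [ae_sphereMeasure_norm_eq_one] with θ hθ
    have hn : ‖r • θ‖ = r := by rw [norm_smul, hθ, mul_one, Real.norm_of_nonneg hr.le]
    rw [evolutionSymbol, gradSymbol, gradSymbol, hn, inner_smul_left, inner_smul_left,
      real_inner_comm x θ]
    ring
  rw [h, radialProfile]
  push_cast
  ring

theorem freeGrad_eq_integral_radialProfile [Nontrivial (Eucl n)] {g : Eucl n → ℂ} {a b : ℝ}
    (ha : 0 < a) (hg : Integrable g) (hs : SupportedInAnnulus a b g) (t : ℝ) (x : Eucl n) :
    IntegrableOn (radialProfile α g x) (Set.Ioi 0) ∧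
    freeGrad α β g (t, x) = ∫ r in Set.Ioi (0 : ℝ),
      Complex.exp (-(t * (2 * Real.pi * r) ^ β : ℝ) * Complex.I) * radialProfile α g x r := by
  have hint : ∀ τ, Integrable (fun ξ : Eucl n =>
      Complex.exp ((2 * Real.pi * inner ℝ ξ x : ℝ) * Complex.I)
      * ((gradSymbol α ξ : ℂ) * evolutionSymbol β τ ξ * g ξ)) := by
    intro τ
    refine (integrable_gradSymbol_mul (α := α) (β := β) ha hg hs τ).bdd_mul (c := 1) ?_ ?_
    · exact (by fun_prop : Continuous fun ξ : Eucl n =>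
        Complex.exp ((2 * Real.pi * inner ℝ ξ x : ℝ) * Complex.I)).aestronglyMeasurable
    · exact Filter.Eventually.of_forall fun ξ => by rw [Complex.norm_exp_ofReal_mul_I]
  constructor
  · refine (integrableOn_polar (hint 0)).congr_fun (fun r hr => ?_) measurableSet_Ioi
    simp only
    rw [sphere_integral_eq_radialProfile g 0 x hr]
    simp
  · rw [freeGrad_eq_integral, integral_eq_polar (hint t)]
    refine setIntegral_congr_fun measurableSet_Ioi fun r hr => ?_
    exact sphere_integral_eq_radialProfile g t x hr

theorem measurable_radialProfile {g : Eucl n → ℂ} (hg : Measurable g) :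
    Measurable (fun p : Eucl n × ℝ => radialProfile α g p.1 p.2) := by
  have h : StronglyMeasurable (fun q : (Eucl n × ℝ) × Eucl n =>
      Complex.exp ((2 * Real.pi * inner ℝ (q.1.2 • q.1.1) q.2 : ℝ) * Complex.I)
        * g (q.1.2 • q.2)) := by
    refine Measurable.stronglyMeasurable ?_
    fun_prop
  have := (h.integral_prod_right' (ν := sphereMeasure n)).measurable
  unfold radialProfile sphereExtension
  refine Measurable.mul ?_ this
  fun_prop

theorem lintegral_comp_smul_eq (f : Eucl n → ℝ≥0∞) {r : ℝ} (hr : 0 < r) :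
    ∫⁻ x, f (r • x) = ENNReal.ofReal (r ^ (-(n : ℝ))) * ∫⁻ x, f x := by
  have h := (Homeomorph.smulOfNeZero r hr.ne' : Eucl n ≃ₜ Eucl n).measurableEmbedding.lintegral_map
    f (μ := volume)
  change ∫⁻ x, f x ∂(Measure.map (r • ·) volume) = ∫⁻ x, f (r • x) at h
  rw [← h, Measure.map_addHaar_smul _ hr.ne', lintegral_smul_measure, finrank_euclideanSpace_fin,
    abs_of_nonneg (by positivity), smul_eq_mul, Real.rpow_neg hr.le, Real.rpow_natCast]

theorem lintegral_weight_comp_smul (F : Eucl n → ℂ) {r : ℝ} (hr : 0 < r) :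
    ∫⁻ x, ENNReal.ofReal (‖x‖ ^ (-γ)) * ‖F (r • x)‖ₑ ^ 2
      = ENNReal.ofReal (r ^ (γ - n)) * ∫⁻ y, ENNReal.ofReal (‖y‖ ^ (-γ)) * ‖F y‖ₑ ^ 2 := by
  have h1 : ∀ x : Eucl n, ENNReal.ofReal (‖x‖ ^ (-γ)) * ‖F (r • x)‖ₑ ^ 2
      = ENNReal.ofReal (r ^ γ) * (ENNReal.ofReal (‖r • x‖ ^ (-γ)) * ‖F (r • x)‖ₑ ^ 2) := by
    intro x
    rw [← mul_assoc, ← ENNReal.ofReal_mul (by positivity), norm_smul, Real.norm_of_nonneg hr.le,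
      Real.mul_rpow hr.le (norm_nonneg x), ← mul_assoc, ← Real.rpow_add hr, add_neg_cancel,
      Real.rpow_zero, one_mul]
  simp_rw [h1]
  rw [lintegral_const_mul' _ _ ENNReal.ofReal_ne_top,
    lintegral_comp_smul_eq (fun y => ENNReal.ofReal (‖y‖ ^ (-γ)) * ‖F y‖ₑ ^ 2) hr, ← mul_assoc,
    ← ENNReal.ofReal_mul (by positivity), ← Real.rpow_add hr, sub_eq_add_neg]

/-- The constant of the space-time estimate. -/
def smoothingConst (β γ : ℝ) (e : Eucl n) : ℝ≥0∞ :=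
  ENNReal.ofReal ((2 * Real.pi) ^ (1 - γ) / |β|) * extensionConst γ e

theorem lintegral_weight_radialProfile (hn : 0 < n) (hγ : γ = β - 2 * α) (g : Eucl n → ℂ) {r : ℝ}
    (hr : 0 < r) :
    ∫⁻ x, ENNReal.ofReal (‖x‖ ^ (-γ)) *
        (‖radialProfile α g x r‖ₑ ^ 2 * ENNReal.ofReal (frequencyDensity β r))
      = ENNReal.ofReal ((2 * Real.pi) ^ (1 - γ) / |β|) * (ENNReal.ofReal (r ^ (n - 1)) *
        ∫⁻ y, ENNReal.ofReal (‖y‖ ^ (-γ)) * ‖sphereExtension (fun θ => g (r • θ)) y‖ₑ ^ 2) := by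
  set A : ℝ := r ^ (n - 1) * (2 * Real.pi * r) ^ α with hA
  have hA0 : 0 ≤ A := by positivity
  have hd0 : 0 ≤ frequencyDensity β r := by unfold frequencyDensity; positivity
  have h1 : ∀ x, ENNReal.ofReal (‖x‖ ^ (-γ)) *
        (‖radialProfile α g x r‖ₑ ^ 2 * ENNReal.ofReal (frequencyDensity β r))
      = ENNReal.ofReal (A ^ 2 * frequencyDensity β r) * (ENNReal.ofReal (‖x‖ ^ (-γ)) *
        ‖sphereExtension (fun θ => g (r • θ)) (r • x)‖ₑ ^ 2) := by
    intro x
    rw [radialProfile, enorm_mul, ← hA, ENNReal.ofReal_mul (by positivity),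
      ENNReal.ofReal_pow hA0, ← ofReal_norm (A : ℂ), Complex.norm_real, Real.norm_of_nonneg hA0]
    ring
  simp_rw [h1]
  rw [lintegral_const_mul' _ _ ENNReal.ofReal_ne_top, lintegral_weight_comp_smul _ hr, ← mul_assoc,
    ← mul_assoc, ← ENNReal.ofReal_mul (by positivity), ← ENNReal.ofReal_mul (by positivity)]
  congr 2
  have hpi : (0 : ℝ) < 2 * Real.pi := by positivity
  have e1 : A ^ 2 = r ^ (2 * ((n : ℝ) - 1)) * ((2 * Real.pi) ^ (2 * α) * r ^ (2 * α)) := by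
    rw [hA, mul_pow, ← Real.rpow_natCast (r ^ (n - 1)) 2, ← Real.rpow_natCast r (n - 1),
      ← Real.rpow_mul hr.le, ← Real.rpow_natCast ((2 * Real.pi * r) ^ α) 2,
      ← Real.rpow_mul (by positivity), Real.mul_rpow hpi.le hr.le, Nat.cast_sub hn]
    push_cast
    simp only [mul_comm α 2, mul_comm ((n : ℝ) - 1) 2]
  have e2 : frequencyDensity β r = (2 * Real.pi) ^ (1 - β) * r ^ (1 - β) / |β| := by
    rw [frequencyDensity, Real.mul_rpow hpi.le hr.le]
  have e3 : r ^ (n - 1) = r ^ ((n : ℝ) - 1) := by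
    rw [← Real.rpow_natCast, Nat.cast_sub hn, Nat.cast_one]
  rw [e1, e2, e3]
  calc _ = ((2 * Real.pi) ^ (2 * α) * (2 * Real.pi) ^ (1 - β)) / |β| *
        (r ^ (2 * ((n : ℝ) - 1)) * r ^ (2 * α) * r ^ (1 - β) * r ^ (γ - n)) := by ring
    _ = _ := by
      rw [← Real.rpow_add hpi, ← Real.rpow_add hr, ← Real.rpow_add hr, ← Real.rpow_add hr, hγ]
      congr 2
      · congr 1; ring
      · ring

/-- The space-time estimate for frequencies in an annulus, with equality if the Fourier transform
of the initial datum is radial. -/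
theorem weightedNormSq_freeGrad [Nontrivial (Eucl n)] (hn : 0 < n) (hβ : β ≠ 0)
    (hγ : γ = β - 2 * α) (h₁ : 1 < γ) (h₂ : γ < n) {e : Eucl n} (he : ‖e‖ = 1)
    {g : Eucl n → ℂ} (hgm : Measurable g) (hg2 : MemLp g 2 volume) {a b : ℝ} (ha : 0 < a)
    (hs : SupportedInAnnulus a b g) :
    weightedNormSq γ (freeGrad α β g) ≤ smoothingConst β γ e * ∫⁻ ξ, ‖g ξ‖ₑ ^ 2 ∧
    ((∃ G : ℝ → ℂ, g =ᵐ[volume] fun ξ => G ‖ξ‖) →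
      weightedNormSq γ (freeGrad α β g) = smoothingConst β γ e * ∫⁻ ξ, ‖g ξ‖ₑ ^ 2) := by
  have hγ0 : 0 < γ := by linarith
  have hg : Integrable g := hg2.integrable_of_supportedInAnnulus hs
  have hfm := measurable_freeGrad (α := α) (β := β) hgm
  have hpm := measurable_radialProfile (α := α) hgm
  set N : ℝ → ℝ≥0∞ := fun r => ∫⁻ θ, ‖g (r • θ)‖ₑ ^ 2 ∂(sphereMeasure n) with hN
  have hNm : Measurable N := by
    have : Measurable fun p : ℝ × Eucl n => ‖g (p.1 • p.2)‖ₑ ^ 2 := by fun_prop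
    exact this.lintegral_prod_right'
  have hgN : ∫⁻ ξ, ‖g ξ‖ₑ ^ 2
      = ∫⁻ r in Set.Ioi (0 : ℝ), ENNReal.ofReal (r ^ (n - 1)) * N r :=
    lintegral_eq_polar (by fun_prop)
  set Q : ℝ → ℝ≥0∞ := fun r => ∫⁻ y, ENNReal.ofReal (‖y‖ ^ (-γ)) *
    ‖sphereExtension (fun θ => g (r • θ)) y‖ₑ ^ 2 with hQ
  -- The time integral for fixed `x`, and its weighted integral over `x`.
  set T : Eucl n → ℝ≥0∞ := fun x => ∫⁻ r in Set.Ioi (0 : ℝ),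
    ‖radialProfile α g x r‖ₑ ^ 2 * ENNReal.ofReal (frequencyDensity β r) with hT
  have hTm : Measurable T := by
    have : Measurable fun p : Eucl n × ℝ =>
        ‖radialProfile α g p.1 p.2‖ₑ ^ 2 * ENNReal.ofReal (frequencyDensity β p.2) := by
      fun_prop
    exact this.lintegral_prod_right'
  have hTQ : ∫⁻ x, ENNReal.ofReal (‖x‖ ^ (-γ)) * T x
      = ∫⁻ r in Set.Ioi (0 : ℝ), ENNReal.ofReal ((2 * Real.pi) ^ (1 - γ) / |β|) *
        (ENNReal.ofReal (r ^ (n - 1)) * Q r) := by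
    calc _ = ∫⁻ x, ∫⁻ r in Set.Ioi (0 : ℝ), ENNReal.ofReal (‖x‖ ^ (-γ)) *
          (‖radialProfile α g x r‖ₑ ^ 2 * ENNReal.ofReal (frequencyDensity β r)) := by
          congr 1 with x
          rw [lintegral_const_mul' _ _ ENNReal.ofReal_ne_top]
      _ = ∫⁻ r in Set.Ioi (0 : ℝ), ∫⁻ x, ENNReal.ofReal (‖x‖ ^ (-γ)) *
          (‖radialProfile α g x r‖ₑ ^ 2 * ENNReal.ofReal (frequencyDensity β r)) := by
          rw [lintegral_lintegral_swap]
          simp only [Function.uncurry_def]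
          fun_prop
      _ = _ := setLIntegral_congr_fun measurableSet_Ioi fun r hr =>
          lintegral_weight_radialProfile hn hγ g hr
  have hconst : smoothingConst β γ e * ∫⁻ ξ, ‖g ξ‖ₑ ^ 2 = ∫⁻ r in Set.Ioi (0 : ℝ),
      ENNReal.ofReal ((2 * Real.pi) ^ (1 - γ) / |β|) *
        (ENNReal.ofReal (r ^ (n - 1)) * (extensionConst γ e * N r)) := by
    rw [hgN, smoothingConst, ← lintegral_const_mul _ (by fun_prop)]
    congr 1 with r
    ring
  have hle : ∫⁻ x, ENNReal.ofReal (‖x‖ ^ (-γ)) * T x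
      ≤ smoothingConst β γ e * ∫⁻ ξ, ‖g ξ‖ₑ ^ 2 := by
    rw [hTQ, hconst]
    refine lintegral_mono_ae ?_
    filter_upwards [ae_integrable_sphereMeasure hg] with r hr
    gcongr
    exact lintegral_weight_sphereExtension_le hγ0 he hr
  have hfin : smoothingConst β γ e * ∫⁻ ξ, ‖g ξ‖ₑ ^ 2 < ∞ := by
    refine ENNReal.mul_lt_top (ENNReal.mul_lt_top ENNReal.ofReal_lt_top
      (extensionConst_lt_top h₁ h₂ he)) ?_
    rw [lintegral_enorm_sq_eq_eLpNorm]
    exact ENNReal.pow_lt_top hg2.2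
  have hWm : Measurable fun x : Eucl n => ENNReal.ofReal (‖x‖ ^ (-γ)) := by fun_prop
  have hTfin : ∀ᵐ x : Eucl n, T x < ∞ := by
    have h0 : ∀ᵐ x : Eucl n, x ≠ 0 := by simp [ae_iff]
    filter_upwards [ae_lt_top (hWm.mul hTm) (hle.trans_lt hfin).ne, h0] with x hx hx0
    by_contra hcon
    have hw : ENNReal.ofReal (‖x‖ ^ (-γ)) ≠ 0 := by
      have := norm_pos_iff.2 hx0
      simpa using by positivity
    rw [not_lt_top_iff] at hcon
    simp only [Pi.mul_apply, hcon, ENNReal.mul_top hw, lt_self_iff_false] at hx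
  have hW : weightedNormSq γ (freeGrad α β g) = ∫⁻ x, ENNReal.ofReal (‖x‖ ^ (-γ)) * T x := by
    rw [weightedNormSq_eq, lintegral_lintegral_swap]
    · refine lintegral_congr_ae ?_
      filter_upwards [hTfin] with x hx
      rw [lintegral_const_mul' _ _ ENNReal.ofReal_ne_top]
      congr 1
      simp_rw [fun t => (freeGrad_eq_integral_radialProfile (α := α) (β := β) ha hg hs t x).2]
      exact lintegral_enorm_sq_integral_oscillation hβ
        (freeGrad_eq_integral_radialProfile (α := α) (β := β) ha hg hs 0 x).1 hx
    · simp only [Function.uncurry_def]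
      fun_prop
  refine ⟨hW ▸ hle, ?_⟩
  rintro ⟨G, hG⟩
  rw [hW, hTQ, hconst]
  refine lintegral_congr_ae ?_
  filter_upwards [ae_ae_sphereMeasure_of_ae hG, ae_restrict_mem measurableSet_Ioi] with r hr hr0
  have hr0 : (0 : ℝ) < r := hr0
  congr 2
  refine lintegral_weight_sphereExtension_of_ae_const hγ0 he (c := G r) ?_
  filter_upwards [hr, ae_sphereMeasure_norm_eq_one] with θ h1 h2
  rw [h1, norm_smul, h2, mul_one, Real.norm_of_nonneg hr0.le]

end FreeGradient

/-! ### General data -/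

section Limit

open Filter Topology

/-- A sequence of functions whose integrals tend to zero tends to zero almost everywhere along a
subsequence. -/
theorem exists_subseq_ae_tendsto_zero {X : Type*} [MeasurableSpace X] {μ : Measure X}
    {F : ℕ → X → ℝ≥0∞} (hF : ∀ k, AEMeasurable (F k) μ)
    (h : Tendsto (fun k => ∫⁻ x, F k x ∂μ) atTop (𝓝 0)) :
    ∃ κ : ℕ → ℕ, StrictMono κ ∧ ∀ᵐ x ∂μ, Tendsto (fun j => F (κ j) x) atTop (𝓝 0) := by
  obtain ⟨κ, hκ, hle⟩ := Filter.extraction_forall_of_eventually'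
    (P := fun j k => ∫⁻ x, F k x ∂μ ≤ 2⁻¹ ^ j) fun j => by
      have hpos : (0 : ℝ≥0∞) < 2⁻¹ ^ j := ENNReal.pow_pos (by simp) j
      obtain ⟨N, hN⟩ := eventually_atTop.1 (h.eventually (ge_mem_nhds hpos))
      exact ⟨N, hN⟩
  refine ⟨κ, hκ, ?_⟩
  have hsum : ∫⁻ x, ∑' j, F (κ j) x ∂μ ≠ ∞ := by
    rw [lintegral_tsum fun j => hF _]
    refine ne_top_of_le_ne_top ?_ (ENNReal.tsum_le_tsum hle)
    rw [ENNReal.tsum_geometric]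
    simp
  filter_upwards [ae_lt_top' (AEMeasurable.tsum fun j => hF _) hsum] with x hx
  exact ENNReal.tendsto_atTop_zero_of_tsum_ne_top hx.ne

theorem eLpNorm_two_eq {X : Type*} [MeasurableSpace X] {μ : Measure X} (f : X → ℂ) :
    eLpNorm f 2 μ = (∫⁻ x, ‖f x‖ₑ ^ 2 ∂μ) ^ (1 / 2 : ℝ) := by
  rw [lintegral_enorm_sq_eq_eLpNorm, ← ENNReal.rpow_natCast, ← ENNReal.rpow_mul]
  norm_num

theorem tendsto_eLpNorm_two_zero {X : Type*} [MeasurableSpace X] {μ : Measure X}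
    {f : ℕ → X → ℂ} (h : Tendsto (fun k => ∫⁻ x, ‖f k x‖ₑ ^ 2 ∂μ) atTop (𝓝 0)) :
    Tendsto (fun k => eLpNorm (f k) 2 μ) atTop (𝓝 0) := by
  simp_rw [eLpNorm_two_eq]
  have := (ENNReal.continuous_rpow_const (y := (1 / 2 : ℝ))).tendsto 0 |>.comp h
  rwa [ENNReal.zero_rpow_of_pos (by norm_num)] at this

theorem lintegral_enorm_mul_le {X : Type*} [MeasurableSpace X] {μ : Measure X} {f p : X → ℂ}
    (hf : AEStronglyMeasurable f μ) (hp : AEStronglyMeasurable p μ) :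
    ∫⁻ x, ‖f x * p x‖ₑ ∂μ ≤ eLpNorm f 2 μ * eLpNorm p 2 μ := by
  have := ENNReal.lintegral_mul_le_Lp_mul_Lq μ Real.HolderConjugate.two_two hf.enorm hp.enorm
  simpa [eLpNorm_two_eq, enorm_mul] using this

variable {n : ℕ} {α β γ : ℝ}

theorem memLp_rpow_mul_schwartz (hγ : 0 < γ) (ψ : 𝓢(Eucl n, ℂ)) :
    MemLp (fun x => ((‖x‖ ^ (γ / 2) : ℝ) : ℂ) * ψ x) 2 volume := by
  have hc : Continuous fun x : Eucl n => ((‖x‖ ^ (γ / 2) : ℝ) : ℂ) * ψ x := by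
    have h1 : Continuous fun x : Eucl n => ‖x‖ ^ (γ / 2) :=
      continuous_norm.rpow_const fun x => Or.inr (by positivity)
    exact (Complex.continuous_ofReal.comp h1).mul ψ.continuous
  rw [memLp_two_iff_integrable_sq_norm hc.aestronglyMeasurable]
  obtain ⟨N, hN⟩ := exists_nat_ge γ
  obtain ⟨B, hB⟩ : ∃ B, ∀ x, ‖ψ x‖ ≤ B := by
    obtain ⟨B, -, hB⟩ := ψ.decay 0 0
    exact ⟨B, fun x => by simpa using hB x⟩
  have hdom : Integrable fun x : Eucl n => B * ‖ψ x‖ + B * (‖x‖ ^ N * ‖ψ x‖) :=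
    ((ψ.integrable (μ := volume)).norm.const_mul B).add
      ((ψ.integrable_pow_mul volume N).const_mul B)
  refine hdom.mono' (hc.norm.pow 2).aestronglyMeasurable (Eventually.of_forall fun x => ?_)
  have h1 : ‖x‖ ^ γ ≤ 1 + ‖x‖ ^ N := by
    rcases le_total ‖x‖ 1 with h | h
    · have := Real.rpow_le_one (norm_nonneg x) h hγ.le
      have : 0 ≤ ‖x‖ ^ N := by positivity
      linarith
    · have := Real.rpow_le_rpow_of_exponent_le h hN
      rw [Real.rpow_natCast] at this
      linarith
  have h2 : (‖x‖ ^ (γ / 2)) ^ 2 = ‖x‖ ^ γ := by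
    rw [← Real.rpow_natCast, ← Real.rpow_mul (norm_nonneg x)]
    congr 1; push_cast; ring
  rw [Real.norm_of_nonneg (by positivity), norm_mul, mul_pow, Complex.norm_real,
    Real.norm_of_nonneg (by positivity), h2]
  calc ‖x‖ ^ γ * ‖ψ x‖ ^ 2 ≤ (1 + ‖x‖ ^ N) * (B * ‖ψ x‖) := by
        rw [sq]; gcongr; exact hB x
    _ = _ := by ring

/-- The space-time function `|x|^(-γ/2) |∇|^α φ (t, x)`. -/
def weightedGrad (α β γ : ℝ) (g : Eucl n → ℂ) (p : ℝ × Eucl n) : ℂ :=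
  ((‖p.2‖ ^ (-(γ / 2)) : ℝ) : ℂ) * freeGrad α β g p

theorem measurable_weightedGrad {g : Eucl n → ℂ} (hg : Measurable g) :
    Measurable (weightedGrad α β γ g) := by
  have := measurable_freeGrad (α := α) (β := β) hg
  unfold weightedGrad
  fun_prop

theorem lintegral_spaceTime {f : ℝ × Eucl n → ℝ≥0∞} (hf : Measurable f) :
    ∫⁻ p, f p = ∫⁻ t : ℝ, ∫⁻ x : Eucl n, f (t, x) := by
  rw [Measure.volume_eq_prod, lintegral_prod _ hf.aemeasurable]

theorem lintegral_enorm_weight_mul_sq {u : ℝ × Eucl n → ℂ} (hu : Measurable u) :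
    ∫⁻ p : ℝ × Eucl n, ‖((‖p.2‖ ^ (-(γ / 2)) : ℝ) : ℂ) * u p‖ₑ ^ 2 = weightedNormSq γ u := by
  rw [weightedNormSq_eq, lintegral_spaceTime (by fun_prop)]
  congr 1 with t
  congr 1 with x
  rw [enorm_mul, mul_pow, ← ofReal_norm ((‖x‖ ^ (-(γ / 2)) : ℝ) : ℂ), Complex.norm_real,
    Real.norm_of_nonneg (by positivity), ← ENNReal.ofReal_pow (by positivity),
    ← Real.rpow_natCast, ← Real.rpow_mul (norm_nonneg x)]
  congr 3
  push_cast
  ring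

theorem freeGrad_sub {g g' : Eucl n → ℂ} {a b a' b' : ℝ} (ha : 0 < a) (ha' : 0 < a')
    (hg : Integrable g) (hg' : Integrable g') (hs : SupportedInAnnulus a b g)
    (hs' : SupportedInAnnulus a' b' g') :
    freeGrad α β (g - g') = freeGrad α β g - freeGrad α β g' := by
  ext p
  have h1 := integrable_gradSymbol_mul (α := α) (β := β) ha hg hs p.1
  have h2 := integrable_gradSymbol_mul (α := α) (β := β) ha' hg' hs' p.1
  have hb : ∀ f : Eucl n → ℂ, Integrable f → Integrable (fun ξ : Eucl n =>
      Complex.exp ((2 * Real.pi * inner ℝ ξ p.2 : ℝ) * Complex.I) * f ξ) := by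
    intro f hf
    refine hf.bdd_mul (c := 1) ?_ ?_
    · exact (by fun_prop : Continuous fun ξ : Eucl n =>
        Complex.exp ((2 * Real.pi * inner ℝ ξ p.2 : ℝ) * Complex.I)).aestronglyMeasurable
    · exact Eventually.of_forall fun ξ => by rw [Complex.norm_exp_ofReal_mul_I]
  rw [Pi.sub_apply, freeGrad_eq_integral, freeGrad_eq_integral, freeGrad_eq_integral,
    ← integral_sub (hb _ h1) (hb _ h2)]
  congr 1 with ξ
  rw [Pi.sub_apply]
  ring

theorem SupportedInAnnulus.sub {g g' : Eucl n → ℂ} {a b a' b' : ℝ}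
    (hs : SupportedInAnnulus a b g) (hs' : SupportedInAnnulus a' b' g') :
    SupportedInAnnulus (min a a') (max b b') (g - g') := by
  intro ξ hξ
  by_cases h : g ξ = 0
  · have h' : g' ξ ≠ 0 := fun h' => hξ (by simp [h, h'])
    exact ⟨(min_le_right _ _).trans (hs' ξ h').1, (hs' ξ h').2.trans (le_max_right _ _)⟩
  · exact ⟨(min_le_left _ _).trans (hs ξ h).1, (hs ξ h).2.trans (le_max_left _ _)⟩

/-- The restriction of a function to the annulus `1 / (k + 1) ≤ ‖ξ‖ ≤ k`. -/
def annulusCutoff (k : ℕ) (g : Eucl n → ℂ) : Eucl n → ℂ :=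
  {ξ : Eucl n | 1 / ((k : ℝ) + 1) ≤ ‖ξ‖ ∧ ‖ξ‖ ≤ k}.indicator g

theorem measurableSet_annulus (k : ℕ) :
    MeasurableSet {ξ : Eucl n | 1 / ((k : ℝ) + 1) ≤ ‖ξ‖ ∧ ‖ξ‖ ≤ k} :=
  (measurableSet_le measurable_const measurable_norm).inter
    (measurableSet_le measurable_norm measurable_const)

theorem supportedInAnnulus_annulusCutoff (k : ℕ) (g : Eucl n → ℂ) :
    SupportedInAnnulus (1 / ((k : ℝ) + 1)) k (annulusCutoff k g) := by
  intro ξ hξ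
  by_contra h
  have hmem : ξ ∉ {ξ : Eucl n | 1 / ((k : ℝ) + 1) ≤ ‖ξ‖ ∧ ‖ξ‖ ≤ k} := h
  exact hξ (Set.indicator_of_notMem hmem g)

theorem norm_annulusCutoff_le (k : ℕ) (g : Eucl n → ℂ) (ξ : Eucl n) :
    ‖annulusCutoff k g ξ‖ ≤ ‖g ξ‖ := norm_indicator_le_norm_self _ _

theorem eventually_annulusCutoff_eq (g : Eucl n → ℂ) {ξ : Eucl n} (hξ : ξ ≠ 0) :
    ∀ᶠ k : ℕ in atTop, annulusCutoff k g ξ = g ξ := by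
  have h1 : ∀ᶠ k : ℕ in atTop, 1 / ((k : ℝ) + 1) < ‖ξ‖ :=
    tendsto_one_div_add_atTop_nhds_zero_nat.eventually_lt_const (norm_pos_iff.2 hξ)
  have h2 : ∀ᶠ k : ℕ in atTop, ‖ξ‖ ≤ k :=
    tendsto_natCast_atTop_atTop.eventually_ge_atTop _
  filter_upwards [h1, h2] with k hk1 hk2
  have hmem : ξ ∈ {ξ : Eucl n | 1 / ((k : ℝ) + 1) ≤ ‖ξ‖ ∧ ‖ξ‖ ≤ k} := ⟨hk1.le, hk2⟩
  exact Set.indicator_of_mem hmem g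

theorem tendsto_eLpNorm_annulusCutoff_sub [Nontrivial (Eucl n)] {g : Eucl n → ℂ}
    (hgm : Measurable g) (hg : MemLp g 2 volume) :
    Tendsto (fun k => eLpNorm (annulusCutoff k g - g) 2 volume) atTop (𝓝 0) := by
  refine tendsto_eLpNorm_two_zero ?_
  have hm : ∀ k, Measurable (annulusCutoff k g) := fun k =>
    hgm.indicator (measurableSet_annulus k)
  rw [← lintegral_zero (μ := (volume : Measure (Eucl n)))]
  refine tendsto_lintegral_of_dominated_convergence (fun ξ => ‖g ξ‖ₑ ^ 2) ?_ ?_ ?_ ?_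
  · exact fun k => (((hm k).sub hgm).enorm.pow_const 2)
  · refine fun k => Eventually.of_forall fun ξ => ?_
    simp only [Pi.sub_apply]
    gcongr
    rw [enorm_le_iff_norm_le]
    by_cases h : ξ ∈ {ξ : Eucl n | 1 / ((k : ℝ) + 1) ≤ ‖ξ‖ ∧ ‖ξ‖ ≤ k}
    · rw [annulusCutoff, Set.indicator_of_mem h, sub_self, norm_zero]
      exact norm_nonneg _
    · rw [annulusCutoff, Set.indicator_of_notMem h, zero_sub, norm_neg]
  · rw [lintegral_enorm_sq_eq_eLpNorm]
    exact (ENNReal.pow_lt_top hg.2).ne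
  · have h0 : ∀ᵐ x : Eucl n, x ≠ 0 := by simp [ae_iff]
    filter_upwards [h0] with ξ hξ
    refine tendsto_const_nhds.congr' ?_
    filter_upwards [eventually_annulusCutoff_eq g hξ] with k hk
    simp [hk]

theorem integral_freeGrad_mul_fourier {g : Eucl n → ℂ} {a b : ℝ} (ha : 0 < a)
    (hg : Integrable g) (hs : SupportedInAnnulus a b g) (t : ℝ) (ψ : 𝓢(Eucl n, ℂ)) :
    ∫ x, freeGrad α β g (t, x) * (𝓕 ψ : 𝓢(Eucl n, ℂ)) x
      = ∫ ξ, (gradSymbol α ξ : ℂ) * evolutionSymbol β t ξ * g ξ * ψ ξ :=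
  integral_fourierInv_mul_fourier (integrable_gradSymbol_mul ha hg hs t) ψ

theorem integrable_freeGrad_mul_schwartz {g : Eucl n → ℂ} (hgm : Measurable g) (t : ℝ)
    (χ : 𝓢(Eucl n, ℂ)) : Integrable fun x => freeGrad α β g (t, x) * χ x := by
  have hm : Measurable fun x => freeGrad α β g (t, x) :=
    (measurable_freeGrad hgm).comp measurable_prodMk_left
  refine (χ.integrable (μ := volume)).bdd_mul
    (c := ∫ ξ : Eucl n, ‖(gradSymbol α ξ : ℂ) * evolutionSymbol β t ξ * g ξ‖)
    hm.aestronglyMeasurable (Eventually.of_forall fun x => ?_)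
  rw [freeGrad_eq_integral]
  refine (norm_integral_le_integral_norm _).trans_eq ?_
  congr 1 with ξ
  rw [norm_mul, Complex.norm_exp_ofReal_mul_I, one_mul]

/-- The pairings of the cut-off functions with test functions converge. -/
theorem tendsto_integral_annulusCutoff_mul [Nontrivial (Eucl n)] {g : Eucl n → ℂ}
    (hgm : Measurable g) (hg : MemLp g 2 volume) (t : ℝ) {ψ : 𝓢(Eucl n, ℂ)}
    (hψ : GradTest α ψ) :
    Tendsto (fun k => ∫ ξ, (gradSymbol α ξ : ℂ) * evolutionSymbol β t ξ * annulusCutoff k g ξ * ψ ξ)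
      atTop (𝓝 (∫ ξ, (gradSymbol α ξ : ℂ) * evolutionSymbol β t ξ * g ξ * ψ ξ)) := by
  have hm : ∀ f : Eucl n → ℂ, Measurable f → Measurable fun ξ : Eucl n =>
      (gradSymbol α ξ : ℂ) * evolutionSymbol β t ξ * f ξ * ψ ξ := fun f hf =>
    (((Complex.measurable_ofReal.comp (measurable_gradSymbol α)).mul
      (measurable_evolutionSymbol β t)).mul hf).mul ψ.continuous.measurable
  have hint : Integrable fun ξ => g ξ * ((gradSymbol α ξ : ℂ) * ψ ξ) := hg.integrable_mul hψ
  refine tendsto_integral_of_dominated_convergence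
    (fun ξ => ‖g ξ * ((gradSymbol α ξ : ℂ) * ψ ξ)‖) ?_ hint.norm ?_ ?_
  · exact fun k => (hm _ (hgm.indicator (measurableSet_annulus k))).aestronglyMeasurable
  · refine fun k => Eventually.of_forall fun ξ => ?_
    simp only [norm_mul, norm_evolutionSymbol, mul_one]
    calc _ ≤ ‖(gradSymbol α ξ : ℂ)‖ * ‖g ξ‖ * ‖ψ ξ‖ := by
          gcongr; exact norm_annulusCutoff_le k g ξ
      _ = _ := by ring
  · have h0 : ∀ᵐ x : Eucl n, x ≠ 0 := by simp [ae_iff]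
    filter_upwards [h0] with ξ hξ
    refine tendsto_const_nhds.congr' ?_
    filter_upwards [eventually_annulusCutoff_eq g hξ] with k hk
    rw [hk]

/-- The space-time estimate on the Fourier side for general `g ∈ L²`. The functions belonging to
the restrictions of `g` to annuli converge in the weighted space, and along a subsequence they
converge in the weighted `L²` space in `x` for almost every `t`. -/
theorem exists_spaceTime_gradient [Nontrivial (Eucl n)] (hn : 0 < n) (hβ : β ≠ 0)
    (hγ : γ = β - 2 * α) (h₁ : 1 < γ) (h₂ : γ < n) {e : Eucl n} (he : ‖e‖ = 1)
    {g : Eucl n → ℂ} (hgm : Measurable g) (hg : MemLp g 2 volume) :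
    ∃ u : ℝ × Eucl n → ℂ, AEStronglyMeasurable u volume ∧
      (∀ᵐ t : ℝ, ∀ ψ : 𝓢(Eucl n, ℂ), GradTest α ψ →
        Integrable (fun x => u (t, x) * (𝓕 ψ : 𝓢(Eucl n, ℂ)) x) ∧
        ∫ x, u (t, x) * (𝓕 ψ : 𝓢(Eucl n, ℂ)) x
          = ∫ ξ, (gradSymbol α ξ : ℂ) * evolutionSymbol β t ξ * g ξ * ψ ξ) ∧
      weightedNormSq γ u ≤ smoothingConst β γ e * ∫⁻ ξ, ‖g ξ‖ₑ ^ 2 ∧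
      ((∃ G : ℝ → ℂ, g =ᵐ[volume] fun ξ => G ‖ξ‖) →
        weightedNormSq γ u = smoothingConst β γ e * ∫⁻ ξ, ‖g ξ‖ₑ ^ 2) := by
  have hγ0 : 0 < γ := by linarith
  set C := smoothingConst β γ e with hC
  have hCtop : C ≠ ∞ := (ENNReal.mul_lt_top ENNReal.ofReal_lt_top
    (extensionConst_lt_top h₁ h₂ he)).ne
  have hx0 : ∀ᵐ x : Eucl n, x ≠ 0 := by simp [ae_iff]
  set gk : ℕ → Eucl n → ℂ := fun k => annulusCutoff k g with hgk
  have hgkm : ∀ k, Measurable (gk k) := fun k => hgm.indicator (measurableSet_annulus k)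
  have hgk2 : ∀ k, MemLp (gk k) 2 volume := fun k =>
    hg.of_le (hgkm k).aestronglyMeasurable
      (Eventually.of_forall fun ξ => norm_annulusCutoff_le k g ξ)
  have hgks : ∀ k : ℕ, SupportedInAnnulus (1 / ((k : ℝ) + 1)) k (gk k) := fun k =>
    supportedInAnnulus_annulusCutoff k g
  have hgki : ∀ k, Integrable (gk k) := fun k => (hgk2 k).integrable_of_supportedInAnnulus (hgks k)
  have hapos : ∀ k : ℕ, 0 < 1 / ((k : ℝ) + 1) := fun k => by positivity
  set V : ℕ → ℝ × Eucl n → ℂ := fun k => weightedGrad α β γ (gk k) with hV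
  have hVm : ∀ k, Measurable (V k) := fun k => measurable_weightedGrad (hgkm k)
  have hVsq : ∀ k, ∫⁻ p, ‖V k p‖ₑ ^ 2 = weightedNormSq γ (freeGrad α β (gk k)) := fun k =>
    lintegral_enorm_weight_mul_sq (measurable_freeGrad (hgkm k))
  have hest := fun k => weightedNormSq_freeGrad hn hβ hγ h₁ h₂ he (hgkm k) (hgk2 k) (hapos k)
    (hgks k)
  have hV2 : ∀ k, MemLp (V k) 2 volume := by
    refine fun k => ⟨(hVm k).aestronglyMeasurable, ?_⟩
    rw [eLpNorm_two_eq, hVsq]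
    refine ENNReal.rpow_lt_top_of_nonneg (by norm_num) (ne_top_of_le_ne_top ?_ (hest k).1)
    rw [lintegral_enorm_sq_eq_eLpNorm]
    exact ENNReal.mul_ne_top hCtop (ENNReal.pow_lt_top (hgk2 k).2).ne
  have hdiff : ∀ k l, eLpNorm (V k - V l) 2 volume ^ 2
      ≤ C * eLpNorm (gk k - gk l) 2 volume ^ 2 := by
    intro k l
    have h := (weightedNormSq_freeGrad (α := α) hn hβ hγ h₁ h₂ he ((hgkm k).sub (hgkm l))
      ((hgk2 k).sub (hgk2 l)) (lt_min (hapos k) (hapos l)) ((hgks k).sub (hgks l))).1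
    rw [← lintegral_enorm_weight_mul_sq (measurable_freeGrad ((hgkm k).sub (hgkm l))),
      freeGrad_sub (hapos k) (hapos l) (hgki k) (hgki l) (hgks k) (hgks l)] at h
    rw [← lintegral_enorm_sq_eq_eLpNorm, ← lintegral_enorm_sq_eq_eLpNorm]
    refine le_trans (le_of_eq ?_) h
    congr 1 with p
    simp only [hV, weightedGrad, Pi.sub_apply]
    rw [mul_sub]
  -- The weighted functions form a Cauchy sequence, as the cut-off functions do.
  set gL : ℕ → L2 n := fun k => (hgk2 k).toLp (gk k) with hgL
  set vL : ℕ → Lp ℂ 2 (volume : Measure (ℝ × Eucl n)) := fun k => (hV2 k).toLp (V k) with hvL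
  have hgLlim : Tendsto gL atTop (𝓝 (hg.toLp g)) :=
    (Lp.tendsto_Lp_iff_tendsto_eLpNorm'' _ hgk2 _ hg).2 (tendsto_eLpNorm_annulusCutoff_sub hgm hg)
  have hdist : ∀ k l, dist (vL k) (vL l) ≤ √C.toReal * dist (gL k) (gL l) := by
    intro k l
    have h := ENNReal.toReal_mono
      (ENNReal.mul_ne_top hCtop (ENNReal.pow_lt_top ((hgk2 k).sub (hgk2 l)).2).ne) (hdiff k l)
    rw [ENNReal.toReal_mul, ENNReal.toReal_pow, ENNReal.toReal_pow] at h
    rw [dist_edist, dist_edist, Lp.edist_toLp_toLp, Lp.edist_toLp_toLp]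
    refine le_of_sq_le_sq ?_ (by positivity)
    rwa [mul_pow, Real.sq_sqrt ENNReal.toReal_nonneg]
  have hcauchy : CauchySeq vL := by
    rw [cauchySeq_iff_tendsto_dist_atTop_0]
    have h0 := (cauchySeq_iff_tendsto_dist_atTop_0.1 hgLlim.cauchySeq).const_mul √C.toReal
    rw [mul_zero] at h0
    exact squeeze_zero (fun _ => dist_nonneg) (fun p => hdist p.1 p.2) h0
  obtain ⟨v, hv⟩ := cauchySeq_tendsto_of_complete hcauchy
  have hvm : Measurable v := (Lp.stronglyMeasurable v).measurable
  -- Convergence of the norms.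
  have hnorm_v : Tendsto (fun k => ∫⁻ p, ‖V k p‖ₑ ^ 2) atTop (𝓝 (∫⁻ p, ‖v p‖ₑ ^ 2)) := by
    have h := ((ENNReal.continuous_pow 2).comp continuous_enorm).tendsto v |>.comp hv
    refine (h.congr fun k => ?_).trans_eq ?_
    · simp only [Function.comp_apply, hvL]
      rw [Lp.enorm_toLp, lintegral_enorm_sq_eq_eLpNorm]
    · simp only [Function.comp_apply]
      rw [Lp.enorm_def, lintegral_enorm_sq_eq_eLpNorm]
  have hnorm_g : Tendsto (fun k => C * ∫⁻ ξ, ‖gk k ξ‖ₑ ^ 2) atTop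
      (𝓝 (C * ∫⁻ ξ, ‖g ξ‖ₑ ^ 2)) := by
    refine ENNReal.Tendsto.const_mul ?_ (Or.inr hCtop)
    have h := ((ENNReal.continuous_pow 2).comp continuous_enorm).tendsto (hg.toLp g) |>.comp hgLlim
    refine (h.congr fun k => ?_).trans_eq ?_
    · simp only [Function.comp_apply, hgL]
      rw [Lp.enorm_toLp, lintegral_enorm_sq_eq_eLpNorm]
    · simp only [Function.comp_apply]
      rw [Lp.enorm_toLp, lintegral_enorm_sq_eq_eLpNorm]
  -- Convergence at almost every time, along a subsequence.
  have hlimF : Tendsto (fun k => ∫⁻ t : ℝ, ∫⁻ x : Eucl n, ‖V k (t, x) - v (t, x)‖ₑ ^ 2) atTop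
      (𝓝 0) := by
    have h := (Lp.tendsto_Lp_iff_tendsto_eLpNorm' vL v).1 hv
    have h2 := (ENNReal.continuous_pow 2).tendsto 0 |>.comp h
    rw [zero_pow two_ne_zero] at h2
    refine h2.congr fun k => ?_
    simp only [Function.comp_apply]
    rw [eLpNorm_congr_ae ((hV2 k).coeFn_toLp.sub (ae_eq_refl _)), ← lintegral_enorm_sq_eq_eLpNorm]
    exact lintegral_spaceTime (((hVm k).sub hvm).enorm.pow_const 2)
  obtain ⟨κ, hκ, hae⟩ := exists_subseq_ae_tendsto_zero (fun k => by
    have : Measurable fun p : ℝ × Eucl n => ‖V k p - v p‖ₑ ^ 2 := by fun_prop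
    exact this.lintegral_prod_right'.aemeasurable) hlimF
  have hvfin : ∀ᵐ t : ℝ, ∫⁻ x : Eucl n, ‖v (t, x)‖ₑ ^ 2 < ∞ := by
    have hm : Measurable fun p : ℝ × Eucl n => ‖v p‖ₑ ^ 2 := by fun_prop
    refine ae_lt_top hm.lintegral_prod_right' ?_
    rw [← lintegral_spaceTime hm, lintegral_enorm_sq_eq_eLpNorm]
    exact (ENNReal.pow_lt_top (Lp.memLp v).2).ne
  have hweight : ∀ x : Eucl n, x ≠ 0 →
      ((‖x‖ ^ (-(γ / 2)) : ℝ) : ℂ) * ((‖x‖ ^ (γ / 2) : ℝ) : ℂ) = 1 := by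
    intro x hx
    rw [← Complex.ofReal_mul, ← Real.rpow_add (norm_pos_iff.2 hx), neg_add_cancel, Real.rpow_zero,
      Complex.ofReal_one]
  set u : ℝ × Eucl n → ℂ := fun p => ((‖p.2‖ ^ (γ / 2) : ℝ) : ℂ) * v p with hu
  have hum : Measurable u := by fun_prop
  have hW : weightedNormSq γ u = ∫⁻ p, ‖v p‖ₑ ^ 2 := by
    rw [← lintegral_enorm_weight_mul_sq hum]
    refine lintegral_congr_ae ?_
    have h0 : ∀ᵐ p : ℝ × Eucl n, p.2 ≠ 0 := by
      rw [Measure.volume_eq_prod]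
      exact Measure.quasiMeasurePreserving_snd.ae hx0
    filter_upwards [h0] with p hp
    rw [hu, ← mul_assoc, hweight _ hp, one_mul]
  refine ⟨u, hum.aestronglyMeasurable, ?_, ?_, ?_⟩
  · filter_upwards [hae, hvfin] with t ht hvt ψ hψ
    have hp := memLp_rpow_mul_schwartz hγ0 (𝓕 ψ : 𝓢(Eucl n, ℂ))
    have hvt_m : Measurable fun x => v (t, x) := hvm.comp measurable_prodMk_left
    have hvt2 : MemLp (fun x => v (t, x)) 2 volume := by
      refine ⟨hvt_m.aestronglyMeasurable, ?_⟩
      rw [eLpNorm_two_eq]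
      exact ENNReal.rpow_lt_top_of_nonneg (by norm_num) hvt.ne
    have hint : Integrable fun x => u (t, x) * (𝓕 ψ : 𝓢(Eucl n, ℂ)) x := by
      refine (hvt2.integrable_mul hp).congr (Eventually.of_forall fun x => ?_)
      simp only [Pi.mul_apply, hu]
      ring
    refine ⟨hint, ?_⟩
    refine tendsto_nhds_unique ?_
      ((tendsto_integral_annulusCutoff_mul (β := β) hgm hg t hψ).comp hκ.tendsto_atTop)
    have hcongr : ∀ k, ∫ ξ, (gradSymbol α ξ : ℂ) * evolutionSymbol β t ξ * annulusCutoff k g ξ * ψ ξ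
        = ∫ x, freeGrad α β (gk k) (t, x) * (𝓕 ψ : 𝓢(Eucl n, ℂ)) x := fun k =>
      (integral_freeGrad_mul_fourier (hapos k) (hgki k) (hgks k) t ψ).symm
    simp only [Function.comp_def, hcongr]
    refine tendsto_integral_of_L1 _ hint.1
      (Eventually.of_forall fun j => integrable_freeGrad_mul_schwartz (hgkm _) t _) ?_
    have hbound : ∀ j, ∫⁻ x, ‖freeGrad α β (gk (κ j)) (t, x) * (𝓕 ψ : 𝓢(Eucl n, ℂ)) x
          - u (t, x) * (𝓕 ψ : 𝓢(Eucl n, ℂ)) x‖ₑ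
        ≤ eLpNorm (fun x => V (κ j) (t, x) - v (t, x)) 2 volume *
          eLpNorm (fun x => ((‖x‖ ^ (γ / 2) : ℝ) : ℂ) * (𝓕 ψ : 𝓢(Eucl n, ℂ)) x) 2 volume := by
      intro j
      have hm : Measurable fun x => V (κ j) (t, x) - v (t, x) :=
        ((hVm _).comp measurable_prodMk_left).sub hvt_m
      refine le_trans (le_of_eq (lintegral_congr_ae ?_))
        (lintegral_enorm_mul_le hm.aestronglyMeasurable hp.1)
      filter_upwards [hx0] with x hx
      congr 1
      simp only [hV, weightedGrad, hu]
      linear_combination (-freeGrad α β (gk (κ j)) (t, x) * (𝓕 ψ : 𝓢(Eucl n, ℂ)) x) * hweight x hx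
    refine tendsto_of_tendsto_of_tendsto_of_le_of_le tendsto_const_nhds ?_ (fun _ => zero_le)
      hbound
    have := ENNReal.Tendsto.mul_const (tendsto_eLpNorm_two_zero ht) (Or.inr hp.2.ne)
    rwa [zero_mul] at this
  · rw [hW]
    exact le_of_tendsto_of_tendsto' hnorm_v hnorm_g fun k => (hVsq k).trans_le (hest k).1
  · rintro ⟨G, hG⟩
    rw [hW]
    refine tendsto_nhds_unique hnorm_v (hnorm_g.congr fun k => ?_)
    rw [hVsq, (hest k).2]
    refine ⟨fun r => {r : ℝ | 1 / ((k : ℝ) + 1) ≤ r ∧ r ≤ k}.indicator G r, ?_⟩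
    filter_upwards [hG] with ξ hξ
    simp only [hgk, annulusCutoff, Set.indicator, Set.mem_ofPred_eq, hξ]
    split_ifs <;> rfl

end Limit
end

theorem theorem1 (n : ℕ) (α β : ℝ) (hβ : β ≠ 0) (h₁ : 1 < β - 2 * α) (h₂ : β - 2 * α < n) :
    ∃ C : ℝ≥0, ∀ (φ₀ : L2 n) (φ : ℝ → L2 n), IsSolution β φ₀ φ →
      ∃ u : ℝ × Eucl n → ℂ, IsSpaceTimeFracGrad α φ u ∧
        weightedNormSq (β - 2 * α) u ≤ (C : ℝ≥0∞) * ENNReal.ofReal (‖φ₀‖ ^ 2) ∧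
        (IsSphericallySymmetric φ₀ →
          weightedNormSq (β - 2 * α) u = (C : ℝ≥0∞) * ENNReal.ofReal (‖φ₀‖ ^ 2)) := by
  have hn : 0 < n := by
    have : (0 : ℝ) < n := by linarith
    exact_mod_cast this
  have : Nonempty (Fin n) := ⟨⟨0, hn⟩⟩
  have : Nontrivial (Eucl n) := inferInstance
  obtain ⟨e, he⟩ := exists_norm_eq (Eucl n) zero_le_one
  have hC : smoothingConst β (β - 2 * α) e < ∞ :=
    ENNReal.mul_lt_top ENNReal.ofReal_lt_top (extensionConst_lt_top h₁ h₂ he)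
  refine ⟨(smoothingConst β (β - 2 * α) e).toNNReal, fun φ₀ φ hφ => ?_⟩
  rw [ENNReal.coe_toNNReal hC.ne]
  have hg := Lp.memLp (𝓕 φ₀ : L2 n)
  obtain ⟨u, hum, hu, hle, heq⟩ := exists_spaceTime_gradient hn hβ rfl h₁ h₂ he
    (Lp.stronglyMeasurable (𝓕 φ₀ : L2 n)).measurable hg
  have hnorm : ∫⁻ ξ, ‖(𝓕 φ₀ : L2 n) ξ‖ₑ ^ 2 = ENNReal.ofReal (‖φ₀‖ ^ 2) := by
    rw [lintegral_enorm_sq_eq_eLpNorm, ← Lp.enorm_def, ← ofReal_norm, Lp.norm_fourier_eq,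
      ENNReal.ofReal_pow (norm_nonneg _)]
  rw [hnorm] at hle heq
  refine ⟨u, ⟨hum, ?_⟩, hle, fun hs => heq (exists_fourier_ae_eq_comp_norm hs)⟩
  filter_upwards [hu] with t ht ψ hψ
  refine ⟨(ht ψ hψ).1, ?_⟩
  rw [(ht ψ hψ).2, gradPairing]
  refine integral_congr_ae ?_
  filter_upwards [fourier_solution_ae_eq hφ t] with ξ hξ
  rw [hξ, mul_assoc (gradSymbol α ξ : ℂ)]
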